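/- Let $Q=R_1(S_1)\Join\dots\Join R_n(S_n)$ be a natural join query with attribute set $\mathrm{att}(Q)=\bigcup_i S_i$, and let $\mathcal T$ be a hypertree decomposition of $Q$: a finite tree whose nodes $u$ carry bags $\chi(u)\subseteq \mathrm{att}(Q)$ such that each $S_i$ is contained in some bag and, for each $A\in \mathrm{att}(Q)$, the nodes whose bag contains $A$ form a non-empty connected subtree. For a database $\mathbf D$ (a finite relation over $S_i$ for each $R_i$, with values in a linearly ordered domain) let $Q(\mathbf D)$ be the set of tuples $t$ over $\mathrm{att}(Q)$ whose restriction to $S_i$ lies in $R_i$ for every $i$, and let $|\mathbf D|$ be the total number of tuples in $\mathbf D$. A *cover* of $Q(\mathbf D)$ over $\mathcal T$ is a finite relation $K$ over $\mathrm{att}(Q)$ such that $\pi_B K=\pi_B Q(\mathbf D)$ for every bag $B$ of $\mathcal T$, and such that no strict subset of $K$ has this property. Then the tuples of $Q(\mathbf D)$ can be enumerated from any cover $K$ of $Q(\mathbf D)$ over $\mathcal T$ with $\widetilde{\mathcal O}(|K|)$ pre-computation time and $\mathcal O(1)$ delay and extra space, on a uniform-cost RAM in which data values can be copied and compared at unit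 cost and all stored integers have $\mathcal O(\log(|K|+2))$ bits, in data complexity. Precisely: for every $Q$, $\mathcal T$ and every order of the attributes as columns, there are RAM programs $\mathsf{pre}$ and $\mathsf{next}$ and a constant $c$ such that, for every linearly ordered domain, every database $\mathbf D$, every cover $K$ of $Q(\mathbf D)$ over $\mathcal T$, and every listing without repetitions of the tuples of $K$ as the input: the program $\mathsf{pre}$ halts on the input after at most $c\,(|K|\lfloor\log_2|\mathbf D|\rfloor+1)$ steps (with $\log_2 0:=0$); then repeated calls of $\mathsf{next}$, each continuing from the memory state left by the previous one, output every tuple of $Q(\mathbf D)$ exactly once, one tuple per call, and the following call reports the end; each of these calls takes at most $c$ steps; all integers stored at any time are at most $(|K|+2)^c$; and there is a set of at most $c$ memory locations (registers included) such that throughout the enumeration phase the memory contents differ from those left by $\mathsf{pre}$ only at these locations. -/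

import Mathlib

namespace CoverEnum

/-! ## Natural join queries, databases, decompositions, covers -/

/-- A natural join query: finitely many relation symbols (indexed by `ι`), each with a finite
schema of attributes from `α`. Distinct relation symbols may have the same schema. -/
structure JoinQuery (ι : Type*) (α : Type*) where
  schema : ι → Finset α

section Joins

variable {ι α N V : Type*} [Fintype ι] [DecidableEq α]

/-- The set of attributes of a query. -/
def JoinQuery.att (Q : JoinQuery ι α) : Finset α := Finset.univ.biUnion Q.schema

theorem JoinQuery.schema_subset_att (Q : JoinQuery ι α) (i : ι) : Q.schema i ⊆ Q.att :=
  Finset.subset_biUnion_of_mem Q.schema (Finset.mem_univ i)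

/-- A tuple over the schema `S`, with data values in `V`. -/
abbrev Tuple (S : Finset α) (V : Type*) := S → V

/-- A database assigns to every relation symbol a finite relation over its schema. -/
abbrev JoinQuery.Database (Q : JoinQuery ι α) (V : Type*) :=
  (i : ι) → Finset (Tuple (Q.schema i) V)

/-- The size of a database: the total number of tuples of its relations. -/
def JoinQuery.dbSize (Q : JoinQuery ι α) (D : Q.Database V) : ℕ := ∑ i, (D i).card

/-- The restriction of a tuple over `S` to the attributes in `B ⊆ S`. -/
def Tuple.restrict {S B : Finset α} (h : B ⊆ S) (t : Tuple S V) : Tuple B V :=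
  fun a => t ⟨a, h a.2⟩

/-- The projection of a set of tuples over `S` onto `B ⊆ S`. -/
def proj {S B : Finset α} (h : B ⊆ S) (R : Set (Tuple S V)) : Set (Tuple B V) :=
  Tuple.restrict h '' R

/-- The query result: the natural join of the relations of the database. -/
def JoinQuery.result (Q : JoinQuery ι α) (D : Q.Database V) : Set (Tuple Q.att V) :=
  {t | ∀ i, Tuple.restrict (Q.schema_subset_att i) t ∈ D i}

/-- A hypertree decomposition of (the hypergraph of) `Q`: a tree on the node type `N` and a bag
of attributes of `Q` for every node, satisfying coverage and connectivity. -/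
structure Decomposition (Q : JoinQuery ι α) (N : Type*) where
  tree : SimpleGraph N
  isTree : tree.IsTree
  bag : N → Finset α
  bag_subset : ∀ n, bag n ⊆ Q.att
  coverage : ∀ i, ∃ n, Q.schema i ⊆ bag n
  /- `Connected` includes that the set of nodes is non-empty. -/
  connectivity : ∀ a ∈ Q.att, (tree.induce {n | a ∈ bag n}).Connected

/-- `K` and the query result have the same projection onto every bag. -/
def ResultPreserving {Q : JoinQuery ι α} (T : Decomposition Q N) (D : Q.Database V)
    (K : Finset (Tuple Q.att V)) : Prop :=
  ∀ n, proj (T.bag_subset n) (K : Set (Tuple Q.att V)) = proj (T.bag_subset n) (Q.result D)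

/-- A cover of the query result over `T`: a minimal result-preserving relation. -/
def IsCover {Q : JoinQuery ι α} (T : Decomposition Q N) (D : Q.Database V)
    (K : Finset (Tuple Q.att V)) : Prop :=
  ResultPreserving T D K ∧ ∀ K' ⊂ K, ¬ ResultPreserving T D K'

end Joins

/-! ## A uniform-cost RAM with data values

Every location, a register or a memory cell, has a slot for a natural number (counter, pointer)
and a slot for a data value. Data values can only be copied and compared. Programs are built from
RAM instructions by sequencing, branching and loops; every instruction and every evaluation of a
test costs one step. -/

/-- Registers are addressed directly by instructions, memory cells indirectly. -/
inductive Loc where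
  | reg (k : ℕ)
  | mem (a : ℕ)
  deriving DecidableEq

/-- A memory state. -/
structure State (V : Type*) where
  num : Loc → ℕ
  dat : Loc → Option V

/-- Elementary instructions; arguments are register names, except `k` in `const`. -/
inductive Instr where
  | const (d k : ℕ)
  | copy (d a : ℕ)
  | add (d a b : ℕ)
  | sub (d a b : ℕ)
  | mul (d a b : ℕ)
  | div (d a b : ℕ)
  | load (d a : ℕ)
  | store (a b : ℕ)
  | copyDat (d a : ℕ)
  | loadDat (d a : ℕ)
  | storeDat (a b : ℕ)

/-- Tests on registers: comparisons of numbers and of data values. -/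
inductive Test where
  | eqNum (a b : ℕ)
  | ltNum (a b : ℕ)
  | eqDat (a b : ℕ)
  | ltDat (a b : ℕ)

/-- RAM programs. -/
inductive Prog where
  | skip
  | instr (i : Instr)
  | seq (p q : Prog)
  | ite (c : Test) (p q : Prog)
  | loop (c : Test) (p : Prog)

section Machine

variable {V : Type*}

open Loc in
/-- The effect of an instruction. `load` and `store` use the number in register `a` as a memory
address. -/
def Instr.apply (s : State V) : Instr → State V
  | const d k => { s with num := Function.update s.num (reg d) k }
  | copy d a => { s with num := Function.update s.num (reg d) (s.num (reg a)) }
  | add d a b => { s with num := Function.update s.num (reg d) (s.num (reg a) + s.num (reg b)) }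
  | sub d a b => { s with num := Function.update s.num (reg d) (s.num (reg a) - s.num (reg b)) }
  | mul d a b => { s with num := Function.update s.num (reg d) (s.num (reg a) * s.num (reg b)) }
  | div d a b => { s with num := Function.update s.num (reg d) (s.num (reg a) / s.num (reg b)) }
  | load d a => { s with num := Function.update s.num (reg d) (s.num (mem (s.num (reg a)))) }
  | store a b => { s with num := Function.update s.num (mem (s.num (reg a))) (s.num (reg b)) }
  | copyDat d a => { s with dat := Function.update s.dat (reg d) (s.dat (reg a)) }
  | loadDat d a => { s with dat := Function.update s.dat (reg d) (s.dat (mem (s.num (reg a)))) }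
  | storeDat a b => { s with dat := Function.update s.dat (mem (s.num (reg a))) (s.dat (reg b)) }

/-- When a test succeeds. A comparison `ltDat` with an empty data slot fails. -/
def Test.Holds [LinearOrder V] (s : State V) : Test → Prop
  | eqNum a b => s.num (Loc.reg a) = s.num (Loc.reg b)
  | ltNum a b => s.num (Loc.reg a) < s.num (Loc.reg b)
  | eqDat a b => s.dat (Loc.reg a) = s.dat (Loc.reg b)
  | ltDat a b => ∃ x y, s.dat (Loc.reg a) = some x ∧ s.dat (Loc.reg b) = some y ∧ x < y

/-- `Exec p s tr s'`: started in state `s`, the program `p` terminates in state `s'`; `tr` lists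
the state after each step, so that its length is the running time. -/
inductive Exec [LinearOrder V] : Prog → State V → List (State V) → State V → Prop
  | skip (s) : Exec .skip s [] s
  | instr (i s) : Exec (.instr i) s [i.apply s] (i.apply s)
  | seq {p q s l s' l' s''} : Exec p s l s' → Exec q s' l' s'' → Exec (.seq p q) s (l ++ l') s''
  | ite_true {c p q s l s'} : c.Holds s → Exec p s l s' → Exec (.ite c p q) s (s :: l) s'
  | ite_false {c p q s l s'} : ¬ c.Holds s → Exec q s l s' → Exec (.ite c p q) s (s :: l) s'
  | loop_false {c p s} : ¬ c.Holds s → Exec (.loop c p) s [s] s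
  | loop_true {c p s l s' l' s''} : c.Holds s → Exec p s l s' → Exec (.loop c p) s' l' s'' →
      Exec (.loop c p) s (s :: (l ++ l')) s''

variable {α : Type*} {S : Finset α} {m : ℕ}

/-- The initial state for a relation listed as `rows`, with columns ordered by `cols`: register
`0` holds the number of rows, the rows are stored one after the other in the data slots of the
memory cells `0, 1, 2, …`, and everything else is blank. -/
def inputState (cols : Fin m ≃ S) (rows : List (Tuple S V)) : State V where
  num := fun
    | .reg 0 => rows.length
    | _ => 0
  dat := fun
    | .reg _ => none
    | .mem a => if h : a % m < m then rows[a / m]?.map (fun t => t (cols ⟨a % m, h⟩)) else none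

/-- `Enumerates next cols c Ok s ts`: when `next` is called again and again, beginning in state
`s` and each time continuing from the state the previous call has left, then the calls report the
tuples of the list `ts` one by one, and the following call reports the end. Every call takes at
most `c` steps, and passes only through states satisfying `Ok`. A call reports the tuple `t` by
leaving `1` in register `0` and the values of `t` in the first `m` data registers; it reports the
end by leaving `0` in register `0`. -/
inductive Enumerates [LinearOrder V] (next : Prog) (cols : Fin m ≃ S) (c : ℕ)
    (Ok : State V → Prop) : State V → List (Tuple S V) → Prop
  | done {s tr s'} : Exec next s tr s' → tr.length ≤ c → (∀ st ∈ tr, Ok st) →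
      s'.num (.reg 0) = 0 → Enumerates next cols c Ok s []
  | more {s tr s' t ts} : Exec next s tr s' → tr.length ≤ c → (∀ st ∈ tr, Ok st) →
      s'.num (.reg 0) = 1 → (∀ j : Fin m, s'.dat (.reg j) = some (t (cols j))) →
      Enumerates next cols c Ok s' ts → Enumerates next cols c Ok s (t :: ts)

/-- All numbers stored in the state `s` are at most `B`. -/
def State.WordBound (B : ℕ) (s : State V) : Prop := ∀ l, s.num l ≤ B

/-- The states `s` and `s'` differ at most at the locations in `W`. -/
def State.AgreeOutside (W : Finset Loc) (s s' : State V) : Prop :=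
  ∀ l ∉ W, s.num l = s'.num l ∧ s.dat l = s'.dat l

end Machine

end CoverEnum

/-! A result-preserving relation `K` determines `Q(D)`: every schema lies in some bag, so a tuple
belongs to `Q(D)` exactly when all its bag projections occur in `K`
(`ResultPreserving.mem_result_iff`). What has to be enumerated is thus the acyclic join of the bag
projections of `K`. These are consistent along the tree, being projections of one relation.

List the bags by distance from a root. By connectivity, the part of a bag that also occurs in
earlier bags, its separator, is contained in the parent bag (`Decomposition.exists_order`). A tuple
of `Q(D)` is then the same as a choice of one row of `K` per bag, each agreeing with the row of the
parent bag on the separator, where rows with equal bag projection are represented by the first of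
them (`mem_tuples`, `nodup_tuples`). Whatever row is chosen at the parent, the child has a match,
namely the representative of that very row (`children_ne_nil`). Hence the choices can be run through
like an odometer that never meets a dead end (`runs_adv`). One move costs a number of steps
depending only on the query and changes registers only.

For the preprocessing, let `N` be the number of rows and `M = N * m` the number of data cells. A
tournament tree sorts the cells in `O(M log M)` steps, giving equal values equal identifiers at most
`M` (`runs_extract`). A projection of a row then becomes a number written in base `M + 1`
(`codeVal_eq_iff`), polynomial in `N`, which can address a table directly. The memory is initially
zero, so such tables need no set-up, and one pass over the rows per bag builds, for every separator
code, the linked list of matching representatives (`runs_buildBag`).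

The logarithm of `|K|` is exchanged for that of `|D|` by `|K| ≤ |D| ^ n` with `n` the number of
relation symbols, because `Q(D)` embeds into the product of the relations
(`ResultPreserving.card_le`, `exists_preTime_le_log`).

Conventions: number registers 1 to 5, 7 and 18 hold constants, 6 tells whether a tuple is pending, 8
counts, 9 is a tree node, 12 a code, `20 + j` the row chosen for bag `j`. Table 0 is the tournament,
table 1 the identifiers; tables `2 + 3 * j`, `3 + 3 * j`, `4 + 3 * j` hold the flags, list heads and
links of bag `j`. Rows are numbered from 1, so that 0 ends a list. -/

namespace CoverEnum

/-! ## A program logic for the RAM -/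

section Logic

variable {V : Type*}

/-- Overwrite a number slot. -/
def State.setNum (s : State V) (l : Loc) (v : ℕ) : State V :=
  { s with num := Function.update s.num l v }

/-- Overwrite a data slot. -/
def State.setDat (s : State V) (l : Loc) (v : Option V) : State V :=
  { s with dat := Function.update s.dat l v }

@[simp] theorem State.num_setNum (s : State V) (l l' : Loc) (v : ℕ) :
    (s.setNum l v).num l' = if l' = l then v else s.num l' := by
  simp [State.setNum, Function.update_apply]

@[simp] theorem State.dat_setNum (s : State V) (l : Loc) (v : ℕ) :
    (s.setNum l v).dat = s.dat := rfl

@[simp] theorem State.dat_setDat (s : State V) (l l' : Loc) (v : Option V) :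
    (s.setDat l v).dat l' = if l' = l then v else s.dat l' := by
  simp [State.setDat, Function.update_apply]

@[simp] theorem State.num_setDat (s : State V) (l : Loc) (v : Option V) :
    (s.setDat l v).num = s.num := rfl

section apply

variable (s : State V) (d a b k : ℕ)

@[simp] theorem apply_const : (Instr.const d k).apply s = s.setNum (.reg d) k := rfl
@[simp] theorem apply_copy : (Instr.copy d a).apply s = s.setNum (.reg d) (s.num (.reg a)) := rfl
@[simp] theorem apply_add : (Instr.add d a b).apply s =
    s.setNum (.reg d) (s.num (.reg a) + s.num (.reg b)) := rfl
@[simp] theorem apply_sub : (Instr.sub d a b).apply s =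
    s.setNum (.reg d) (s.num (.reg a) - s.num (.reg b)) := rfl
@[simp] theorem apply_mul : (Instr.mul d a b).apply s =
    s.setNum (.reg d) (s.num (.reg a) * s.num (.reg b)) := rfl
@[simp] theorem apply_div : (Instr.div d a b).apply s =
    s.setNum (.reg d) (s.num (.reg a) / s.num (.reg b)) := rfl
@[simp] theorem apply_load : (Instr.load d a).apply s =
    s.setNum (.reg d) (s.num (.mem (s.num (.reg a)))) := rfl
@[simp] theorem apply_store : (Instr.store a b).apply s =
    s.setNum (.mem (s.num (.reg a))) (s.num (.reg b)) := rfl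
@[simp] theorem apply_copyDat : (Instr.copyDat d a).apply s =
    s.setDat (.reg d) (s.dat (.reg a)) := rfl
@[simp] theorem apply_loadDat : (Instr.loadDat d a).apply s =
    s.setDat (.reg d) (s.dat (.mem (s.num (.reg a)))) := rfl

end apply

/-- The number that the instruction computes is at most `B`. -/
def Instr.Fits (B : ℕ) (s : State V) : Instr → Prop
  | .const _ k => k ≤ B
  | .add _ a b => s.num (.reg a) + s.num (.reg b) ≤ B
  | .mul _ a b => s.num (.reg a) * s.num (.reg b) ≤ B
  | _ => True

theorem State.WordBound.setNum {B v : ℕ} {s : State V} (hs : s.WordBound B) (l : Loc)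
    (hv : v ≤ B) : (s.setNum l v).WordBound B := by
  intro l'
  rw [State.num_setNum]
  split
  · exact hv
  · exact hs l'

theorem Instr.wordBound_apply {B : ℕ} {s : State V} {i : Instr} (hi : i.Fits B s)
    (hs : s.WordBound B) : (i.apply s).WordBound B := by
  cases i with
  | const d k => exact hs.setNum _ hi
  | copy d a => exact hs.setNum _ (hs _)
  | add d a b => exact hs.setNum _ hi
  | sub d a b => exact hs.setNum _ ((Nat.sub_le _ _).trans (hs _))
  | mul d a b => exact hs.setNum _ hi
  | div d a b => exact hs.setNum _ ((Nat.div_le_self _ _).trans (hs _))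
  | load d a => exact hs.setNum _ (hs _)
  | store a b => exact hs.setNum _ (hs _)
  | copyDat d a => exact hs
  | loadDat d a => exact hs
  | storeDat a b => exact hs

/-- A straight-line program. -/
def blk : List Instr → Prog
  | [] => .skip
  | i :: l => .seq (.instr i) (blk l)

/-- All numbers computed by the straight-line program are at most `B`. -/
def FitsAll (B : ℕ) : State V → List Instr → Prop
  | _, [] => True
  | s, i :: l => i.Fits B s ∧ FitsAll B (i.apply s) l

variable [LinearOrder V]

/-- Started in `s`, where all numbers are at most `B`, the program `p` terminates within `t` steps
in a state satisfying `Q`, and all numbers remain at most `B`. -/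
def Runs (B : ℕ) (p : Prog) (t : ℕ) (Q : State V → Prop) (s : State V) : Prop :=
  s.WordBound B → ∃ tr s', Exec p s tr s' ∧ tr.length ≤ t ∧ (∀ st ∈ tr, st.WordBound B) ∧
    s'.WordBound B ∧ Q s'

namespace Runs

variable {B t t' : ℕ} {p q : Prog} {c : Test} {Q Q' : State V → Prop} {s : State V}

theorem mono (h : Runs B p t Q s) (ht : t ≤ t') (hQ : ∀ s', Q s' → Q' s') :
    Runs B p t' Q' s := by
  intro hs
  obtain ⟨tr, s', h1, h2, h3, h4, h5⟩ := h hs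
  exact ⟨tr, s', h1, h2.trans ht, h3, h4, hQ _ h5⟩

theorem weaken (h : Runs B p t Q s) (hQ : ∀ s', Q s' → Q' s') : Runs B p t Q' s :=
  h.mono le_rfl hQ

theorem skip (h : Q s) : Runs B .skip 0 Q s :=
  fun hs => ⟨[], s, .skip s, le_rfl, by simp, hs, h⟩

theorem seq (h : Runs B p t (Runs B q t' Q) s) : Runs B (.seq p q) (t + t') Q s := by
  intro hs
  obtain ⟨tr, s', h1, h2, h3, h4, h5⟩ := h hs
  obtain ⟨tr', s'', g1, g2, g3, g4, g5⟩ := h5 h4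
  refine ⟨tr ++ tr', s'', .seq h1 g1, by simp; omega, ?_, g4, g5⟩
  intro st hst
  rcases List.mem_append.1 hst with hst | hst
  · exact h3 _ hst
  · exact g3 _ hst

theorem ite (h : c.Holds s → Runs B p t Q s) (h' : ¬ c.Holds s → Runs B q t' Q s) :
    Runs B (.ite c p q) (1 + max t t') Q s := by
  intro hs
  by_cases hc : c.Holds s
  · obtain ⟨tr, s', h1, h2, h3, h4, h5⟩ := h hc hs
    exact ⟨s :: tr, s', .ite_true hc h1, by simp; omega, by simpa using ⟨hs, h3⟩, h4, h5⟩
  · obtain ⟨tr, s', h1, h2, h3, h4, h5⟩ := h' hc hs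
    exact ⟨s :: tr, s', .ite_false hc h1, by simp; omega, by simpa using ⟨hs, h3⟩, h4, h5⟩

theorem loop_stop (h : ¬ c.Holds s) (hQ : Q s) : Runs B (.loop c p) 1 Q s :=
  fun hs => ⟨[s], s, .loop_false h, le_rfl, by simpa using hs, hs, hQ⟩

theorem loop_next (hc : c.Holds s) (h : Runs B p t (Runs B (.loop c p) t' Q) s) :
    Runs B (.loop c p) (1 + (t + t')) Q s := by
  intro hs
  obtain ⟨tr, s', h1, h2, h3, h4, h5⟩ := h hs
  obtain ⟨tr', s'', g1, g2, g3, g4, g5⟩ := h5 h4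
  refine ⟨s :: (tr ++ tr'), s'', .loop_true hc h1 g1, by simp; omega, ?_, g4, g5⟩
  intro st hst
  simp only [List.mem_cons, List.mem_append] at hst
  rcases hst with rfl | hst | hst
  · exact hs
  · exact h3 _ hst
  · exact g3 _ hst

/-- The number of iterations is known in advance, so an invariant indexed by the round gives
termination and the time bound at once. The summands 1 pay for evaluations of the test. -/
theorem loop (I : ℕ → State V → Prop) (n : ℕ)
    (step : ∀ i < n, ∀ s, I i s → c.Holds s ∧ Runs B p t (I (i + 1)) s)
    (halt : ∀ s, I n s → ¬ c.Holds s) (init : I 0 s) :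
    Runs B (.loop c p) (n * (t + 1) + 1) (I n) s := by
  suffices H : ∀ j i s, i + j = n → I i s → Runs B (.loop c p) (j * (t + 1) + 1) (I n) s from
    H n 0 s (by omega) init
  intro j
  induction j with
  | zero =>
    intro i s hi hI
    obtain rfl : i = n := by omega
    exact (loop_stop (halt s hI) hI).mono (by simp) fun _ h => h
  | succ j ih =>
    intro i s hi hI
    obtain ⟨hc, hr⟩ := step i (by omega) s hI
    refine (loop_next hc (hr.weaken fun s' h => ih (i + 1) s' (by omega) h)).mono ?_ fun _ h => h
    linarith

theorem blk {l : List Instr} (hl : FitsAll B s l) (hQ : Q (l.foldl Instr.apply s)) :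
    Runs B (CoverEnum.blk l) l.length Q s := by
  induction l generalizing s with
  | nil => exact Runs.skip hQ
  | cons i l ih =>
    rw [List.length_cons, add_comm]
    refine Runs.seq ?_
    intro hs
    have := Instr.wordBound_apply hl.1 hs
    exact ⟨[i.apply s], i.apply s, .instr i s, le_rfl, by simpa using this, this, ih hl.2 hQ⟩

end Runs

end Logic

/-! ## Tables in the memory -/

section Tables

variable {V : Type*}

/-- The entry `x` of the table with tag `τ`, where the tables are interleaved with stride `C`. -/
def tab (C : ℕ) (s : State V) (τ x : ℕ) : ℕ := s.num (.mem (x * C + τ))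

/-- Division with remainder by `C`. A fixed stride keeps the tables disjoint whatever their lengths;
the same fact later gives uniqueness of digits in codes. -/
theorem addr_inj {C τ τ' x x' : ℕ} (h : τ < C) (h' : τ' < C) :
    x * C + τ = x' * C + τ' ↔ τ = τ' ∧ x = x' := by
  constructor
  · intro e
    have e1 := congrArg (· % C) e
    have e2 := congrArg (· / C) e
    have hC : 0 < C := by omega
    simp only [Nat.mul_add_mod', Nat.mod_eq_of_lt h, Nat.mod_eq_of_lt h'] at e1
    rw [mul_comm x, mul_comm x'] at e2
    simp only [Nat.mul_add_div hC, Nat.div_eq_of_lt h, Nat.div_eq_of_lt h'] at e2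
    omega
  · rintro ⟨rfl, rfl⟩
    rfl

/-- Number registers outside `X`, data registers outside `Y`, and the data memory are the same. -/
structure Frame (X Y : List ℕ) (s s' : State V) : Prop where
  num : ∀ i ∉ X, s'.num (.reg i) = s.num (.reg i)
  dat : ∀ i ∉ Y, s'.dat (.reg i) = s.dat (.reg i)
  mem : ∀ a, s'.dat (.mem a) = s.dat (.mem a)

theorem Frame.refl {X Y : List ℕ} (s : State V) : Frame X Y s s :=
  ⟨fun _ _ => rfl, fun _ _ => rfl, fun _ => rfl⟩

theorem Frame.trans {X Y X' Y' : List ℕ} {s s' s'' : State V} (h : Frame X Y s s')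
    (h' : Frame X' Y' s' s'') (hX : X' ⊆ X) (hY : Y' ⊆ Y) : Frame X Y s s'' :=
  ⟨fun i hi => (h'.num i fun h => hi (hX h)).trans (h.num i hi),
    fun i hi => (h'.dat i fun h => hi (hY h)).trans (h.dat i hi),
    fun a => (h'.mem a).trans (h.mem a)⟩

theorem Frame.mono {X Y X' Y' : List ℕ} {s s' : State V} (h : Frame X Y s s')
    (hX : X ⊆ X') (hY : Y ⊆ Y') : Frame X' Y' s s' :=
  (Frame.refl s).trans h hX hY

theorem Frame.setNum {X Y : List ℕ} {s s' : State V} (h : Frame X Y s s') {d : ℕ} (hd : d ∈ X)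
    (v : ℕ) : Frame X Y s (s'.setNum (.reg d) v) := by
  refine ⟨fun i hi => ?_, h.dat, h.mem⟩
  have : i ≠ d := fun e => hi (e ▸ hd)
  simpa [this] using h.num i hi

theorem Frame.setDat {X Y : List ℕ} {s s' : State V} (h : Frame X Y s s') {d : ℕ} (hd : d ∈ Y)
    (v : Option V) : Frame X Y s (s'.setDat (.reg d) v) := by
  refine ⟨h.num, fun i hi => ?_, fun a => ?_⟩
  · have : i ≠ d := fun e => hi (e ▸ hd)
    simpa [this] using h.dat i hi
  · simpa using h.mem a

/-- Read entry `reg x` of table `τ` into register `d`. -/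
def rd (τ x d : ℕ) : List Instr := [.mul 10 x 2, .const 11 τ, .add 10 10 11, .load d 10]

/-- Write register `y` to entry `reg x` of table `τ`. -/
def wr (τ x y : ℕ) : List Instr := [.mul 10 x 2, .const 11 τ, .add 10 10 11, .store 10 y]

end Tables

/-! ### Constants in registers, address bounds and the effect of writes on tables -/

section Context

variable {V : Type*}

/-- The constants that the programs keep in registers, and the data memory `inp`. -/
structure Ctx (C m M : ℕ) (inp : ℕ → Option V) (s : State V) : Prop where
  r1 : s.num (.reg 1) = 1
  r2 : s.num (.reg 2) = C
  r3 : s.num (.reg 3) = m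
  r4 : s.num (.reg 4) = M
  r5 : s.num (.reg 5) = M + 1
  r7 : s.num (.reg 7) = 0
  r18 : s.num (.reg 18) = 2
  data : ∀ a, s.dat (.mem a) = inp a

theorem Ctx.frame {C m M : ℕ} {inp : ℕ → Option V} {s s' : State V} {X Y : List ℕ}
    (h : Ctx C m M inp s) (hf : Frame X Y s s')
    (hX : ∀ i ∈ [1, 2, 3, 4, 5, 7, 18], i ∉ X) : Ctx C m M inp s' where
  r1 := (hf.num _ (hX _ (by simp))).trans h.r1
  r2 := (hf.num _ (hX _ (by simp))).trans h.r2
  r3 := (hf.num _ (hX _ (by simp))).trans h.r3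
  r4 := (hf.num _ (hX _ (by simp))).trans h.r4
  r5 := (hf.num _ (hX _ (by simp))).trans h.r5
  r7 := (hf.num _ (hX _ (by simp))).trans h.r7
  r18 := (hf.num _ (hX _ (by simp))).trans h.r18
  data a := (hf.mem a).trans (h.data a)

theorem Ctx.setNum {C m M : ℕ} {inp : ℕ → Option V} {s : State V} (h : Ctx C m M inp s) {d : ℕ}
    (hd : d ∉ [1, 2, 3, 4, 5, 7, 18]) (v : ℕ) : Ctx C m M inp (s.setNum (.reg d) v) :=
  h.frame (X := [d]) (Y := []) ((Frame.refl s).setNum (by simp) v) (by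
    intro i hi h
    rw [List.mem_singleton] at h
    exact hd (h ▸ hi))

theorem Ctx.setDat {C m M : ℕ} {inp : ℕ → Option V} {s : State V} (h : Ctx C m M inp s) (d : ℕ)
    (v : Option V) : Ctx C m M inp (s.setDat (.reg d) v) :=
  h.frame (X := []) (Y := [d]) ((Frame.refl s).setDat (by simp) v) (by simp)

/-- Table indices up to `X` and tags below `C` give addresses below `B`. -/
structure Cap (B C X : ℕ) : Prop where
  two_le : 2 ≤ C
  le : (X + 1) * C ≤ B

namespace Cap

variable {B C X x τ : ℕ}

theorem addr (h : Cap B C X) (hx : x ≤ X) (hτ : τ < C) : x * C + τ ≤ B := by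
  have h1 := h.le
  have h2 : x * C ≤ X * C := Nat.mul_le_mul_right _ hx
  nlinarith

theorem mul (h : Cap B C X) (hx : x ≤ X) : x * C ≤ B :=
  h.addr (τ := 0) hx (by have := h.two_le; omega)

theorem idx (h : Cap B C X) (hx : x ≤ X) : x ≤ B :=
  (Nat.le_mul_of_pos_right x (by have := h.two_le; omega)).trans (h.mul hx)

theorem tag (h : Cap B C X) (hτ : τ < C) : τ ≤ B := by
  simpa using h.addr (Nat.zero_le X) hτ

end Cap

theorem tab_setNum_mem {C : ℕ} {s : State V} {τ x τ' x' v : ℕ} (h : τ < C) (h' : τ' < C) :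
    tab C (s.setNum (.mem (x * C + τ)) v) τ' x' =
      if τ' = τ ∧ x' = x then v else tab C s τ' x' := by
  simp [tab, addr_inj h' h]

@[simp] theorem tab_setNum_reg {C : ℕ} {s : State V} {τ x d v : ℕ} :
    tab C (s.setNum (.reg d) v) τ x = tab C s τ x := by
  simp [tab]

@[simp] theorem tab_setDat {C : ℕ} {s : State V} {τ x : ℕ} {l : Loc} {v : Option V} :
    tab C (s.setDat l v) τ x = tab C s τ x := rfl

end Context

/-! ### Tournament trees in which blank cells lose -/

section Tournament

variable {V : Type*} [LinearOrder V]

/-- Comparison of data slots, as made by the machine. -/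
def DatLt (a b : Option V) : Prop := ∃ x y, a = some x ∧ b = some y ∧ x < y

open Classical in
/-- The winner among the cells `a` and `b`. -/
noncomputable def sel (inp : ℕ → Option V) (a b : ℕ) : ℕ :=
  if inp a = none then b else if DatLt (inp b) (inp a) then b else a

/-- Recompute the winner at the node in register `9`. -/
def recomp : Prog :=
  .seq (blk ([.mul 13 9 18] ++ rd 0 13 14 ++ [.add 13 13 1] ++ rd 0 13 15 ++
      [.loadDat 0 14, .loadDat 1 15]))
    (.ite (.eqDat 0 2) (blk (wr 0 9 15)) (.ite (.ltDat 1 0) (blk (wr 0 9 15)) (blk (wr 0 9 14))))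

variable {B C m M X : ℕ} {inp : ℕ → Option V} {s : State V}

/-- Registers 10 and 11 are overwritten while the address is computed, hence the restriction on `y`.
-/
theorem runs_wr {τ x y : ℕ} (hB : Cap B C X) (hs : Ctx C m M inp s) (hτ : τ < C)
    (hX : s.num (.reg x) ≤ X) (hy : y ≠ 10 ∧ y ≠ 11) :
    Runs B (blk (wr τ x y)) 4 (fun s' => Frame [10, 11] [] s s' ∧
      ∀ τ' < C, ∀ x', tab C s' τ' x' = if τ' = τ ∧ x' = s.num (.reg x) then s.num (.reg y)
        else tab C s τ' x') s := by
  refine Runs.blk ?_ ⟨⟨?_, ?_, ?_⟩, ?_⟩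
  · simp [FitsAll, Instr.Fits, wr, hs.r2, hB.mul hX, hB.tag hτ, hB.addr hX hτ]
  · intro i hi
    simp only [List.mem_cons, List.not_mem_nil, or_false, not_or] at hi
    simp [wr, hi]
  · simp [wr]
  · simp [wr]
  · intro τ' hτ' x'
    simp [wr, hs.r2, tab_setNum_mem hτ hτ', hy]

theorem runs_rd {τ x d : ℕ} (hB : Cap B C X) (hs : Ctx C m M inp s) (hτ : τ < C)
    (hX : s.num (.reg x) ≤ X) :
    Runs B (blk (rd τ x d)) 4 (fun s' => Frame [10, 11, d] [] s s' ∧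
      s'.num (.reg d) = tab C s τ (s.num (.reg x)) ∧
      ∀ τ' < C, ∀ x', tab C s' τ' x' = tab C s τ' x') s := by
  refine Runs.blk ?_ ⟨⟨?_, ?_, ?_⟩, ?_, ?_⟩
  · simp [FitsAll, Instr.Fits, rd, hs.r2, hB.mul hX, hB.tag hτ, hB.addr hX hτ]
  · intro i hi
    simp only [List.mem_cons, List.not_mem_nil, or_false, not_or] at hi
    simp [rd, hi]
  · simp [rd]
  · simp [rd]
  · simp [rd, hs.r2, tab]
  · simp [rd]

/-- Comparing with the blank data register 2 detects a blank left child. A blank right child needs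
no test of its own, since `ltDat` fails on blank slots. -/
theorem runs_recomp {v : ℕ} (hB : Cap B C X) (hs : Ctx C m M inp s) (hb : s.dat (.reg 2) = none)
    (hv : s.num (.reg 9) = v) (hX : 2 * v + 1 ≤ X) :
    Runs B recomp 18 (fun s' => Frame [10, 11, 13, 14, 15] [0, 1] s s' ∧
      ∀ τ < C, ∀ x, tab C s' τ x = if τ = 0 ∧ x = v then
        sel inp (tab C s 0 (2 * v)) (tab C s 0 (2 * v + 1)) else tab C s τ x) s := by
  have hC := hB.two_le
  have b1 := hB.idx hX
  have b2 := hB.mul hX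
  have b3 := hB.mul (x := 2 * v) (by omega)
  set Q : State V → Prop := fun s' => Frame [10, 11, 13, 14, 15] [0, 1] s s' ∧
    s'.num (.reg 14) = tab C s 0 (2 * v) ∧ s'.num (.reg 15) = tab C s 0 (2 * v + 1) ∧
    s'.dat (.reg 0) = inp (tab C s 0 (2 * v)) ∧ s'.dat (.reg 1) = inp (tab C s 0 (2 * v + 1)) ∧
    ∀ τ < C, ∀ x, tab C s' τ x = tab C s τ x with hQ
  refine Runs.mono (t := 12 + (1 + max 4 (1 + max 4 4))) (Runs.seq (Runs.weaken (Q := Q)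
    (Runs.blk ?_ ?_) ?_)) (by norm_num) (fun _ h => h)
  · simp [FitsAll, Instr.Fits, rd, hs.r1, hs.r2, hs.r18, hv, mul_comm v 2]
    omega
  · simp only [rd, List.cons_append, List.nil_append, List.foldl_cons, List.foldl_nil]
    refine ⟨⟨?_, ?_, ?_⟩, ?_⟩
    · intro i hi
      simp only [List.mem_cons, List.not_mem_nil, or_false, not_or] at hi
      simp [hi]
    · intro i hi
      simp only [List.mem_cons, List.not_mem_nil, or_false, not_or] at hi
      simp [hi]
    · simp
    · simp [hs.r1, hs.r2, hs.r18, hv, mul_comm v 2, tab, hs.data]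
  · rintro s₁ ⟨hf, h14, h15, d0, d1, ht⟩
    have hs₁ := hs.frame hf (by decide)
    have h9 : s₁.num (.reg 9) = v := (hf.num 9 (by decide)).trans hv
    have hb₁ : s₁.dat (.reg 2) = none := (hf.dat 2 (by decide)).trans hb
    have key : ∀ y w, (y = 14 ∨ y = 15) → s₁.num (.reg y) = w →
        w = sel inp (tab C s 0 (2 * v)) (tab C s 0 (2 * v + 1)) →
        Runs B (blk (wr 0 9 y)) 4 (fun s' => Frame [10, 11, 13, 14, 15] [0, 1] s s' ∧
          ∀ τ < C, ∀ x, tab C s' τ x = if τ = 0 ∧ x = v then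
          sel inp (tab C s 0 (2 * v)) (tab C s 0 (2 * v + 1)) else tab C s τ x) s₁ := by
      rintro y w hy rfl hw
      refine (runs_wr hB hs₁ (by omega) (by omega) (by omega)).weaken ?_
      rintro s' ⟨hf', ht'⟩
      refine ⟨hf.trans hf' (by simp) (by simp), fun τ hτ x => ?_⟩
      rw [ht' τ hτ x, h9, hw, ht τ hτ]
    refine Runs.ite (fun h1 => key 15 _ (by simp) h15 ?_) fun h1 =>
      Runs.ite (fun h2 => key 15 _ (by simp) h15 ?_) fun h2 => key 14 _ (by simp) h14 ?_
    all_goals simp only [Test.Holds, d0, d1, hb₁] at *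
    · rw [sel, if_pos h1]
    · rw [sel, if_neg h1, if_pos (show DatLt _ _ from h2)]
    · rw [sel, if_neg h1, if_neg (show ¬ DatLt _ _ from h2)]

/-- `b` is not smaller than `a`, where empty slots are the largest. -/
def DatLe (a b : Option V) : Prop := b = none ∨ ∃ x y, a = some x ∧ b = some y ∧ x ≤ y

theorem DatLe.refl (a : Option V) : DatLe a a := by
  cases a <;> simp [DatLe]

theorem DatLe.trans {a b c : Option V} (h : DatLe a b) (h' : DatLe b c) : DatLe a c := by
  cases a <;> cases b <;> cases c <;> simp_all [DatLe]
  exact h.trans h'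

theorem DatLe.antisymm {a b : Option V} (h : DatLe a b) (h' : DatLe b a) : a = b := by
  cases a <;> cases b <;> simp_all [DatLe]
  exact h.antisymm h'

theorem sel_le_left (a b : ℕ) : DatLe (inp (sel inp a b)) (inp a) := by
  unfold sel
  split_ifs with h h'
  · simp [DatLe, h]
  · obtain ⟨x, y, hx, hy, hl⟩ := h'
    exact Or.inr ⟨x, y, hx, hy, hl.le⟩
  · exact DatLe.refl _

theorem sel_le_right (a b : ℕ) : DatLe (inp (sel inp a b)) (inp b) := by
  unfold sel
  split_ifs with h h'
  · exact DatLe.refl _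
  · exact DatLe.refl _
  · cases ha : inp a <;> cases hb : inp b <;> simp_all [DatLe, DatLt]

theorem sel_eq_or (a b : ℕ) : sel inp a b = a ∨ sel inp a b = b := by
  unfold sel
  split_ifs <;> simp

/-- The entry of `T` at the inner node `u` is the winner among the children. -/
def HeapAt (inp : ℕ → Option V) (T : ℕ → ℕ) (u : ℕ) : Prop :=
  T u = sel inp (T (2 * u)) (T (2 * u + 1))

/-- Induction along the path from `u` to the root: the winner at `u / 2` is not larger than either
child. -/
theorem heap_root_le {T : ℕ → ℕ} (h : ∀ u, 1 ≤ u → u < M → HeapAt inp T u) {u : ℕ} (h1 : 1 ≤ u)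
    (hu : u < 2 * M) : DatLe (inp (T 1)) (inp (T u)) := by
  induction u using Nat.strong_induction_on with
  | _ u ih =>
    rcases h1.eq_or_lt with rfl | h1
    · exact DatLe.refl _
    · refine (ih (u / 2) (by omega) (by omega) (by omega)).trans ?_
      rw [h (u / 2) (by omega) (by omega)]
      rcases Nat.mod_two_eq_zero_or_one u with h2 | h2
      · have : 2 * (u / 2) = u := by omega
        rw [this]
        exact sel_le_left _ _
      · have : 2 * (u / 2) + 1 = u := by omega
        rw [this]
        exact sel_le_right _ _

/-- Follow the winner downwards: an inner node copies one of its children, and `2 * M - u`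
decreases. -/
theorem heap_mem_leaf {T : ℕ → ℕ} (h : ∀ u, 1 ≤ u → u < M → HeapAt inp T u) {u : ℕ} (h1 : 1 ≤ u)
    (hu : u < 2 * M) : ∃ i < M, T u = T (M + i) := by
  induction hn : 2 * M - u using Nat.strong_induction_on generalizing u with
  | _ n ih =>
    by_cases hM : u < M
    · rcases sel_eq_or (inp := inp) (T (2 * u)) (T (2 * u + 1)) with h2 | h2
      · rw [h u h1 hM, h2]
        exact ih _ (by omega) (by omega) (by omega) rfl
      · rw [h u h1 hM, h2]
        exact ih _ (by omega) (by omega) (by omega) rfl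
    · exact ⟨u - M, by omega, by congr 1; omega⟩

/-- The condition at `u` involves only the nodes `u`, `2 * u` and `2 * u + 1`, so a change at `v`
can spoil it only at `v` and at the parent `v / 2`. -/
theorem heapAt_update {T : ℕ → ℕ} {u v w : ℕ} (hu : HeapAt inp T u) (h1 : v ≠ u)
    (h2 : u ≠ v / 2) : HeapAt inp (Function.update T v w) u := by
  unfold HeapAt
  rw [Function.update_of_ne (by omega), Function.update_of_ne (by omega),
    Function.update_of_ne (by omega)]
  exact hu

theorem heapAt_update_self {T : ℕ → ℕ} {v : ℕ} (hv : 1 ≤ v) :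
    HeapAt inp (Function.update T v (sel inp (T (2 * v)) (T (2 * v + 1)))) v := by
  unfold HeapAt
  rw [Function.update_self, Function.update_of_ne (by omega), Function.update_of_ne (by omega)]

end Tournament

/-! ### Building and repairing the tournament -/

section Identifiers

variable {V : Type*} [LinearOrder V] {B C m M X : ℕ} {inp : ℕ → Option V} {s : State V}

/-- Put `i` at the leaf `M + i` of the tournament tree. -/
def initLeaves : Prog :=
  .seq (blk [.const 8 0])
    (.loop (.ltNum 8 4) (.seq (blk [.add 9 4 8]) (.seq (blk (wr 0 9 8)) (blk [.add 8 8 1]))))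

theorem runs_initLeaves (hB : Cap B C X) (hs : Ctx C m M inp s) (hX : 2 * M + 1 ≤ X) :
    Runs B initLeaves (1 + (M * (1 + (4 + 1) + 1) + 1)) (fun s' => Frame [8, 9, 10, 11] [] s s' ∧
      (∀ i < M, tab C s' 0 (M + i) = i) ∧
      ∀ τ < C, 0 < τ → ∀ x, tab C s' τ x = tab C s τ x) s := by
  have hC := hB.two_le
  have b1 := hB.idx hX
  refine Runs.seq (Runs.blk ?_ ?_)
  · simp [FitsAll, Instr.Fits]
  refine Runs.weaken (Runs.loop (fun i s' => Frame [8, 9, 10, 11] [] s s' ∧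
    s'.num (.reg 8) = i ∧ (∀ i' < i, tab C s' 0 (M + i') = i') ∧
      ∀ τ < C, 0 < τ → ∀ x, tab C s' τ x = tab C s τ x) M ?_ ?_ ?_) ?_
  · rintro i hi s₁ ⟨hf₁, h8, h0, ht₁⟩
    have hs₁ := hs.frame hf₁ (by decide)
    refine ⟨by simpa [Test.Holds, h8, hs₁.r4], ?_⟩
    refine Runs.seq (Runs.blk ?_ ?_)
    · simp [FitsAll, Instr.Fits, h8, hs₁.r4]
      omega
    simp only [List.foldl_cons, List.foldl_nil, apply_add, h8, hs₁.r4]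
    have hs₂ := hs₁.setNum (d := 9) (by decide) (M + i)
    have hf₂ := hf₁.setNum (d := 9) (by decide) (M + i)
    refine Runs.seq (t := 4) (t' := 1) ((runs_wr (τ := 0) (x := 9) (y := 8) hB hs₂ (by omega)
      (by simp; omega) (by decide)).weaken ?_)
    rintro s₃ ⟨hf₃, ht₃⟩
    have hs₃ := hs₂.frame hf₃ (by decide)
    have h8₃ : s₃.num (.reg 8) = i := by rw [hf₃.num 8 (by decide)]; simp [h8]
    refine Runs.blk ?_ ⟨(hf₂.trans hf₃ (by simp) (by simp)).setNum (by simp) _, ?_, ?_, ?_⟩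
    · simp [FitsAll, Instr.Fits, hs₃.r1, h8₃]
      omega
    · simp [hs₃.r1, h8₃]
    · intro i' hi'
      simp only [List.foldl_cons, List.foldl_nil, apply_add, tab_setNum_reg]
      rw [ht₃ 0 (by omega)]
      rcases Nat.lt_succ_iff_lt_or_eq.1 hi' with hi' | rfl
      · simp [hi'.ne, h0 _ hi']
      · simp [h8]
    · intro τ hτ h x
      simp only [List.foldl_cons, List.foldl_nil, apply_add, tab_setNum_reg]
      rw [ht₃ τ hτ]
      simp [h.ne', ht₁ τ hτ h]
  · rintro s₁ ⟨hf₁, h8, -⟩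
    have hs₁ := hs.frame hf₁ (by decide)
    simp [Test.Holds, h8, hs₁.r4]
  · exact ⟨(Frame.refl s).setNum (by simp) _, by simp, by simp, by simp⟩
  · rintro s' ⟨h1, -, h2, h3⟩
    exact ⟨h1, h2, h3⟩

/-- Compute the winners at all inner nodes of the tournament tree. -/
def buildTree : Prog :=
  .seq (blk [.copy 9 4]) (.loop (.ltNum 1 9) (.seq (blk [.sub 9 9 1]) recomp))

theorem runs_buildTree (hB : Cap B C X) (hs : Ctx C m M inp s) (hb : s.dat (.reg 2) = none)
    (hX : 2 * M + 1 ≤ X) :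
    Runs B buildTree (1 + ((M - 1) * (1 + 18 + 1) + 1))
      (fun s' => Frame [9, 10, 11, 13, 14, 15] [0, 1] s s' ∧
        (∀ i, tab C s' 0 (M + i) = tab C s 0 (M + i)) ∧
        (∀ u, 1 ≤ u → u < M → HeapAt inp (tab C s' 0) u) ∧
        ∀ τ < C, 0 < τ → ∀ x, tab C s' τ x = tab C s τ x) s := by
  have hC := hB.two_le
  refine Runs.seq (Runs.blk (by simp [FitsAll, Instr.Fits]) ?_)
  -- After `i` rounds the nodes from `M - i` on are correct. Going downwards, children are finished
  -- before their parent.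
  refine Runs.weaken (Runs.loop (fun i s' => Frame [9, 10, 11, 13, 14, 15] [0, 1] s s' ∧
    s'.num (.reg 9) = M - i ∧ (∀ i, tab C s' 0 (M + i) = tab C s 0 (M + i)) ∧
      (∀ u, 1 ≤ u → M - i ≤ u → u < M → HeapAt inp (tab C s' 0) u) ∧
      ∀ τ < C, 0 < τ → ∀ x, tab C s' τ x = tab C s τ x) (M - 1) ?_ ?_ ?_) ?_
  · rintro i hi s₁ ⟨hf₁, h9, h0, hh, ht₁⟩
    have hs₁ := hs.frame hf₁ (by decide)
    refine ⟨by simp [Test.Holds, h9, hs₁.r1]; omega, ?_⟩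
    refine Runs.seq (Runs.blk (by simp [FitsAll, Instr.Fits]) ?_)
    simp only [List.foldl_cons, List.foldl_nil, apply_sub, h9, hs₁.r1]
    have hs₂ := hs₁.setNum (d := 9) (by decide) (M - i - 1)
    have hf₂ := hf₁.setNum (d := 9) (by decide) (M - i - 1)
    refine (runs_recomp hB hs₂ ((hf₂.dat 2 (by decide)).trans hb) (by simp; rfl)
      (by omega)).weaken ?_
    rintro s₃ ⟨hf₃, ht₃⟩
    refine ⟨hf₂.trans hf₃ (by simp) (by simp), ?_, ?_, ?_, ?_⟩
    · rw [hf₃.num 9 (by decide)]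
      simp
      omega
    · intro i'
      have : M + i' ≠ M - i - 1 := by omega
      simp [ht₃ 0 (by omega), this, h0]
    · have hT : tab C s₃ 0 = Function.update (tab C s₁ 0) (M - i - 1)
          (sel inp (tab C s₁ 0 (2 * (M - i - 1))) (tab C s₁ 0 (2 * (M - i - 1) + 1))) := by
        funext x
        simp [ht₃ 0 (by omega), Function.update_apply]
      intro u h1 h2 h3
      rw [hT]
      rcases eq_or_ne u (M - i - 1) with rfl | hu
      · exact heapAt_update_self h1
      · exact heapAt_update (hh u h1 (by omega) h3) hu.symm (by omega)
    · intro τ hτ h x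
      simp [ht₃ τ hτ, h.ne', ht₁ τ hτ h]
  · rintro s₁ ⟨hf₁, h9, -⟩
    have hs₁ := hs.frame hf₁ (by decide)
    simp [Test.Holds, h9, hs₁.r1]
    omega
  · exact ⟨(Frame.refl s).setNum (by simp) _, by simp [hs.r4], by simp, by intros; omega, by simp⟩
  · rintro s' ⟨h1, -, h2, h3, h4⟩
    exact ⟨h1, h2, fun u hu => h3 u hu (by omega), h4⟩

/-- Recompute the winners at the proper ancestors of the node in register `9`. -/
def fixPath : Prog := .loop (.ltNum 1 9) (.seq (blk [.div 9 9 18]) recomp)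

/-- The only possible defect is at the parent of `v`. Recomputing there moves the defect one level
up, until `v = 1`, whose parent 0 is not a node. The bound `v < 2 ^ (L + 1)` allows at most `L`
halvings. -/
theorem runs_fixPath {v L : ℕ} (hB : Cap B C X) (hs : Ctx C m M inp s)
    (hb : s.dat (.reg 2) = none) (hX : 2 * M + 1 ≤ X) (hv : s.num (.reg 9) = v) (h1v : 1 ≤ v)
    (hvM : v < 2 * M) (hL : v < 2 ^ (L + 1))
    (hh : ∀ u, 1 ≤ u → u < M → u ≠ v / 2 → HeapAt inp (tab C s 0) u) :
    Runs B fixPath (L * (1 + 18 + 1) + 1)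
      (fun s' => Frame [9, 10, 11, 13, 14, 15] [0, 1] s s' ∧
        (∀ i, tab C s' 0 (M + i) = tab C s 0 (M + i)) ∧
        (∀ u, 1 ≤ u → u < M → HeapAt inp (tab C s' 0) u) ∧
        ∀ τ < C, 0 < τ → ∀ x, tab C s' τ x = tab C s τ x) s := by
  have hC := hB.two_le
  induction L generalizing s v with
  | zero =>
    obtain rfl : v = 1 := by omega
    exact (Runs.loop_stop (by simp [Test.Holds, hv, hs.r1]) ⟨Frame.refl _, fun _ => rfl,
      fun u h1 h2 => hh u h1 h2 (by omega), fun _ _ _ _ => rfl⟩).mono (by simp) fun _ h => h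
  | succ L ih =>
    by_cases hv1 : v = 1
    · subst hv1
      exact (Runs.loop_stop (by simp [Test.Holds, hv, hs.r1]) ⟨Frame.refl _, fun _ => rfl,
        fun u h1 h2 => hh u h1 h2 (by omega), fun _ _ _ _ => rfl⟩).mono (by simp) fun _ h => h
    · refine Runs.mono (Runs.loop_next (t := 1 + 18) (t' := L * (1 + 18 + 1) + 1) ?_ ?_)
        (by linarith) fun _ h => h
      · simp [Test.Holds, hv, hs.r1]
        omega
      refine Runs.seq (Runs.blk (by simp [FitsAll, Instr.Fits]) ?_)
      simp only [List.foldl_cons, List.foldl_nil, apply_div, hv, hs.r18]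
      have hs₂ := hs.setNum (d := 9) (by decide) (v / 2)
      have hf₂ := (Frame.refl (X := [9, 10, 11, 13, 14, 15]) (Y := [0, 1]) s).setNum (d := 9)
        (by decide) (v / 2)
      refine (runs_recomp hB hs₂ ((hf₂.dat 2 (by decide)).trans hb) (by simp; rfl)
        (by omega)).weaken ?_
      rintro s₃ ⟨hf₃, ht₃⟩
      have hf := hf₂.trans hf₃ (by simp) (by simp)
      have hT : tab C s₃ 0 = Function.update (tab C s 0) (v / 2)
          (sel inp (tab C s 0 (2 * (v / 2))) (tab C s 0 (2 * (v / 2) + 1))) := by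
        funext x
        simp [ht₃ 0 (by omega), Function.update_apply]
      refine (ih (v := v / 2) (hs.frame hf (by decide)) ((hf.dat 2 (by decide)).trans hb) ?_
        (by omega) (by omega) (by rw [pow_succ] at hL; omega) ?_).weaken ?_
      · rw [hf₃.num 9 (by decide)]
        simp
      · intro u h1 h2 h3
        rw [hT]
        rcases eq_or_ne u (v / 2) with rfl | hu
        · exact heapAt_update_self h1
        · exact heapAt_update (hh u h1 h2 hu) hu.symm h3
      · rintro s' ⟨g1, g2, g3, g4⟩
        refine ⟨hf.trans g1 (by simp) (by simp), fun i => ?_, g3, fun τ hτ h x => ?_⟩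
        · rw [g2, hT, Function.update_of_ne (by omega)]
        · rw [g4 τ hτ h]
          simp [ht₃ τ hτ, h.ne']

end Identifiers

/-! ### Extraction in increasing order and identifiers of data values -/

section Extract

variable {V : Type*} [LinearOrder V] {B C m M X : ℕ} {inp : ℕ → Option V} {s : State V}

/-- The cells in `D` have been extracted in increasing order, the last one having the content `last`
and the identifier `cnt`. -/
structure Extracted (inp : ℕ → Option V) (M : ℕ) (D : Finset ℕ) (last : Option V) (cnt : ℕ)
    (ID : ℕ → ℕ) : Prop where
  subset : D ⊆ Finset.range M
  cnt_le : cnt ≤ D.card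
  id_le : ∀ r ∈ D, ID r ≤ cnt
  id_eq : ∀ r ∈ D, ∀ r' ∈ D, ID r = ID r' ↔ inp r = inp r'
  id_last : ∀ r ∈ D, ID r = cnt ↔ inp r = last
  le_last : ∀ r ∈ D, DatLe (inp r) last
  last_le : D.Nonempty → ∀ r < M, r ∉ D → DatLe last (inp r)

theorem Extracted.insert_same {D : Finset ℕ} {last : Option V} {cnt r : ℕ} {ID ID' : ℕ → ℕ}
    (h : Extracted inp M D last cnt ID) (hr : r < M) (hrD : r ∉ D)
    (hmin : ∀ r' < M, r' ∉ D → DatLe (inp r) (inp r')) (hlast : inp r = last)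
    (hID : ∀ r', ID' r' = if r' = r then cnt else ID r') :
    Extracted inp M (insert r D) last cnt ID' := by
  have hne : ∀ r' ∈ D, r' ≠ r := fun r' h e => hrD (e ▸ h)
  have hsame : ∀ r' ∈ D, ID' r' = ID r' := fun r' h => by rw [hID, if_neg (hne r' h)]
  have hself : ID' r = cnt := by simp [hID]
  refine ⟨?_, ?_, ?_, ?_, ?_, ?_, ?_⟩
  · exact Finset.insert_subset (Finset.mem_range.2 hr) h.subset
  · rw [Finset.card_insert_of_notMem hrD]
    exact h.cnt_le.trans (Nat.le_succ _)
  · intro r' hr'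
    rcases Finset.mem_insert.1 hr' with rfl | hr'
    · exact hself.le
    · rw [hsame r' hr']
      exact h.id_le r' hr'
  · intro a ha b hb
    rcases Finset.mem_insert.1 ha with rfl | ha' <;> rcases Finset.mem_insert.1 hb with rfl | hb'
    · simp
    · rw [hself, hsame b hb', hlast, eq_comm, h.id_last b hb', eq_comm]
    · rw [hself, hsame a ha', hlast, h.id_last a ha']
    · rw [hsame a ha', hsame b hb', h.id_eq a ha' b hb']
  · intro a ha
    rcases Finset.mem_insert.1 ha with rfl | ha
    · simp [hself, hlast]
    · rw [hsame a ha, h.id_last a ha]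
  · intro a ha
    rcases Finset.mem_insert.1 ha with rfl | ha
    · rw [hlast]
      exact DatLe.refl _
    · exact h.le_last a ha
  · intro _ a ha haD
    rw [Finset.mem_insert, not_or] at haD
    rw [← hlast]
    exact hmin a ha haD.2

/-- Extraction is monotone: an extracted cell is at most `last`, and `last` is at most the new cell.
A new cell equal to any extracted one would therefore equal `last`, so comparing with `last` alone
decides whether a fresh identifier is due. -/
theorem Extracted.insert_new {D : Finset ℕ} {last : Option V} {cnt r : ℕ} {ID ID' : ℕ → ℕ}
    (h : Extracted inp M D last cnt ID) (hr : r < M) (hrD : r ∉ D)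
    (hmin : ∀ r' < M, r' ∉ D → DatLe (inp r) (inp r')) (hlast : inp r ≠ last)
    (hID : ∀ r', ID' r' = if r' = r then cnt + 1 else ID r') :
    Extracted inp M (insert r D) (inp r) (cnt + 1) ID' := by
  have hne : ∀ r' ∈ D, r' ≠ r := fun r' h e => hrD (e ▸ h)
  have hsame : ∀ r' ∈ D, ID' r' = ID r' := fun r' h => by rw [hID, if_neg (hne r' h)]
  have hself : ID' r = cnt + 1 := by simp [hID]
  have hle : ∀ a ∈ D, DatLe (inp a) (inp r) := fun a ha =>
    (h.le_last a ha).trans (h.last_le ⟨a, ha⟩ r hr hrD)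
  have hneq : ∀ a ∈ D, inp a ≠ inp r := fun a ha e =>
    hlast ((h.last_le ⟨a, ha⟩ r hr hrD).antisymm (e ▸ h.le_last a ha)).symm
  have hlt : ∀ a ∈ D, ID a ≠ cnt + 1 := fun a ha => by have := h.id_le a ha; omega
  refine ⟨?_, ?_, ?_, ?_, ?_, ?_, ?_⟩
  · exact Finset.insert_subset (Finset.mem_range.2 hr) h.subset
  · rw [Finset.card_insert_of_notMem hrD]
    exact Nat.succ_le_succ h.cnt_le
  · intro r' hr'
    rcases Finset.mem_insert.1 hr' with rfl | hr'
    · exact hself.le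
    · rw [hsame r' hr']
      exact (h.id_le r' hr').trans (Nat.le_succ _)
  · intro a ha b hb
    rcases Finset.mem_insert.1 ha with rfl | ha' <;> rcases Finset.mem_insert.1 hb with rfl | hb'
    · simp
    · rw [hself, hsame b hb']
      exact iff_of_false (hlt b hb').symm (hneq b hb').symm
    · rw [hself, hsame a ha']
      exact iff_of_false (hlt a ha') (hneq a ha')
    · rw [hsame a ha', hsame b hb', h.id_eq a ha' b hb']
  · intro a ha
    rcases Finset.mem_insert.1 ha with rfl | ha
    · simp [hself]
    · rw [hsame a ha]
      exact iff_of_false (hlt a ha) (hneq a ha)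
  · intro a ha
    rcases Finset.mem_insert.1 ha with rfl | ha
    · exact DatLe.refl _
    · exact hle a ha
  · intro _ a ha haD
    rw [Finset.mem_insert, not_or] at haD
    exact hmin a ha haD.2

/-- An extracted leaf points to the blank cell `M`, which ranks above all data. While some cell
remains, the root is at most the contents of that cell, hence not blank, so it comes from a leaf
that has not been extracted. -/
theorem heap_root_spec {D : Finset ℕ} {T : ℕ → ℕ} (hM : inp M = none)
    (hinp : ∀ r < M, inp r ≠ none) (hcard : D.card < M)
    (hh : ∀ u, 1 ≤ u → u < M → HeapAt inp T u)
    (hl : ∀ r < M, T (M + r) = if r ∈ D then M else r) :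
    T 1 < M ∧ T 1 ∉ D ∧ ∀ r < M, r ∉ D → DatLe (inp (T 1)) (inp r) := by
  have hle : ∀ r < M, r ∉ D → DatLe (inp (T 1)) (inp r) := by
    intro r hr hrD
    have := heap_root_le hh (u := M + r) (by omega) (by omega)
    rwa [hl r hr, if_neg hrD] at this
  obtain ⟨r, hr, hrD⟩ : ∃ r ∈ Finset.range M, r ∉ D := by
    by_contra! H
    have := Finset.card_le_card (show Finset.range M ⊆ D from H)
    rw [Finset.card_range] at this
    omega
  rw [Finset.mem_range] at hr
  obtain ⟨i, hi, hTi⟩ := heap_mem_leaf hh (u := 1) le_rfl (by omega)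
  rw [hl i hi] at hTi
  split_ifs at hTi with hiD
  · have := hle r hr hrD
    rw [hTi, hM] at this
    rcases this with h | ⟨x, y, h, -⟩
    · exact absurd h (hinp r hr)
    · simp at h
  · exact ⟨by omega, by rwa [hTi], hle⟩

/-- One round of extraction: the winner gets an identifier and leaves the tournament. -/
def extractStep : Prog :=
  .seq (blk [.add 8 8 1]) (.seq (blk (rd 0 1 17)) (.seq (blk [.loadDat 0 17])
    (.seq (.ite (.eqDat 0 3) .skip (blk [.add 16 16 1, .copyDat 3 0]))
      (.seq (blk (wr 1 17 16)) (.seq (blk [.add 9 4 17]) (.seq (blk (wr 0 9 4)) fixPath))))))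

/-- Extract all cells. -/
def extract : Prog :=
  .seq (blk [.const 8 0, .const 16 0]) (.loop (.ltNum 8 4) extractStep)

/-- The state of the tournament after `i` rounds of extraction. -/
def ExtractInv (C M : ℕ) (inp : ℕ → Option V) (s₀ : State V) (i : ℕ) (s : State V) : Prop :=
  Frame [8, 9, 10, 11, 13, 14, 15, 16, 17] [0, 1, 3] s₀ s ∧ s.num (.reg 8) = i ∧
  (∀ τ < C, 1 < τ → ∀ x, tab C s τ x = tab C s₀ τ x) ∧
  (∀ u, 1 ≤ u → u < M → HeapAt inp (tab C s 0) u) ∧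
  ∃ D : Finset ℕ, D.card = i ∧ (∀ r < M, tab C s 0 (M + r) = if r ∈ D then M else r) ∧
    Extracted inp M D (s.dat (.reg 3)) (s.num (.reg 16)) (tab C s 1)

theorem runs_extractStep {i L : ℕ} {s₀ : State V} (hB : Cap B C X) (hs₀ : Ctx C m M inp s₀)
    (hb : s₀.dat (.reg 2) = none) (hX : 2 * M + 1 ≤ X) (hM : inp M = none)
    (hinp : ∀ r < M, inp r ≠ none) (hL : 2 * M ≤ 2 ^ (L + 1)) (hi : i < M)
    (hinv : ExtractInv C M inp s₀ i s) :
    Runs B extractStep (20 * L + 19) (ExtractInv C M inp s₀ (i + 1)) s := by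
  have hC := hB.two_le
  have b1 := hB.idx hX
  obtain ⟨hf, h8, ht, hh, D, hD, hl, hE⟩ := hinv
  have hs := hs₀.frame hf (by decide)
  obtain ⟨r1, r2, r3⟩ := heap_root_spec hM hinp (by omega) hh hl
  set r := tab C s 0 1 with hr
  refine Runs.mono (t := 1 + (4 + (1 + ((1 + max 0 2) + (4 + (1 + (4 + (L * (1 + 18 + 1) + 1))))))))
    (Runs.seq (Runs.blk ?_ ?_)) (by norm_num; omega) (fun _ h => h)
  · simp [FitsAll, Instr.Fits, h8, hs.r1]
    omega
  simp only [List.foldl_cons, List.foldl_nil, apply_add, h8, hs.r1]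
  have hs₁ := hs.setNum (d := 8) (by decide) (i + 1)
  have hf₁ := hf.setNum (d := 8) (by decide) (i + 1)
  refine Runs.seq ((runs_rd (τ := 0) (x := 1) (d := 17) hB hs₁ (by omega)
    (by simp [hs.r1]; omega)).weaken ?_)
  rintro s₂ ⟨hf₂, h17, ht₂⟩
  have h17 : s₂.num (.reg 17) = r := by rw [h17]; simp [hs.r1, hr]
  have hs₂ := hs₁.frame hf₂ (by decide)
  have hf₂' := hf₁.trans hf₂ (by simp) (by simp)
  have h8₂ : s₂.num (.reg 8) = i + 1 := by rw [hf₂.num 8 (by decide)]; simp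
  have h16₂ : s₂.num (.reg 16) = s.num (.reg 16) := by rw [hf₂.num 16 (by decide)]; simp
  have h3₂ : s₂.dat (.reg 3) = s.dat (.reg 3) := by rw [hf₂.dat 3 (by decide)]; simp
  refine Runs.seq (Runs.blk (by simp [FitsAll, Instr.Fits]) ?_)
  simp only [List.foldl_cons, List.foldl_nil, apply_loadDat, h17, hs₂.data]
  have hs₃ := hs₂.setDat 0 (inp r)
  have hf₃ := hf₂'.setDat (d := 0) (by decide) (inp r)
  have hcnt := hE.cnt_le
  -- The identifier of `r` is written only after the branch, so the intermediate condition speaks of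
  -- every table `ID'` that will differ from the present one just at `r`.
  refine Runs.seq (Runs.weaken (Q := fun s' => Ctx C m M inp s' ∧
    Frame [8, 9, 10, 11, 13, 14, 15, 16, 17] [0, 1, 3] s₀ s' ∧ s'.num (.reg 8) = i + 1 ∧
    s'.num (.reg 17) = r ∧ (∀ τ < C, ∀ x, tab C s' τ x = tab C s τ x) ∧
    ∀ ID' : ℕ → ℕ, (∀ r', ID' r' = if r' = r then s'.num (.reg 16) else tab C s 1 r') →
      Extracted inp M (insert r D) (s'.dat (.reg 3)) (s'.num (.reg 16)) ID')
    (Runs.ite (fun h => Runs.skip ?_) fun h => Runs.blk ?_ ?_) ?_)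
  · simp only [Test.Holds, State.dat_setDat, if_true, h3₂] at h
    simp only [Loc.reg.injEq, OfNat.ofNat_ne_zero, if_false] at h
    refine ⟨hs₃, hf₃, by simpa using h8₂, by simpa using h17, fun τ hτ x => ?_, fun ID' hID => ?_⟩
    · simpa using ht₂ τ hτ x
    · simp only [State.num_setDat, h16₂] at hID ⊢
      simpa [h3₂] using hE.insert_same r1 r2 r3 h hID
  · simp [FitsAll, Instr.Fits, h16₂, hs₂.r1]
    omega
  · simp only [Test.Holds, State.dat_setDat, if_true, h3₂] at h
    simp only [Loc.reg.injEq, OfNat.ofNat_ne_zero, if_false] at h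
    simp only [List.foldl_cons, List.foldl_nil, apply_add, apply_copyDat]
    refine ⟨(hs₃.setNum (by decide) _).setDat _ _,
      (hf₃.setNum (by decide) _).setDat (by decide) _, by simpa using h8₂, by simpa using h17,
      fun τ hτ x => ?_, fun ID' hID => ?_⟩
    · simpa using ht₂ τ hτ x
    · simp only [State.num_setDat, State.num_setNum, if_true, h16₂, hs₂.r1] at hID ⊢
      simpa [h3₂] using hE.insert_new r1 r2 r3 h hID
  rintro s₄ ⟨hs₄, hf₄, h8₄, h17₄, ht₄, hE₄⟩
  refine Runs.seq ((runs_wr (τ := 1) (x := 17) (y := 16) hB hs₄ (by omega) (by omega)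
    (by decide)).weaken ?_)
  rintro s₅ ⟨hf₅, ht₅⟩
  have hs₅ := hs₄.frame hf₅ (by decide)
  have hf₅' := hf₄.trans hf₅ (by simp) (by simp)
  have h17₅ : s₅.num (.reg 17) = r := by rw [hf₅.num 17 (by decide), h17₄]
  refine Runs.seq (Runs.blk ?_ ?_)
  · simp [FitsAll, Instr.Fits, h17₅, hs₅.r4]
    omega
  simp only [List.foldl_cons, List.foldl_nil, apply_add, h17₅, hs₅.r4]
  have hs₆ := hs₅.setNum (d := 9) (by decide) (M + r)
  have hf₆ := hf₅'.setNum (d := 9) (by decide) (M + r)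
  -- Register 4 holds `M`, the index of the blank cell: writing it into leaf `M + r` removes `r`
  -- from the tournament.
  refine Runs.seq ((runs_wr (τ := 0) (x := 9) (y := 4) hB hs₆ (by omega) (by simp; omega)
    (by decide)).weaken ?_)
  rintro s₇ ⟨hf₇, ht₇⟩
  have hs₇ := hs₆.frame hf₇ (by decide)
  have hf₇' := hf₆.trans hf₇ (by simp) (by simp)
  have hT₇ : tab C s₇ 0 = Function.update (tab C s 0) (M + r) M := by
    funext x
    simp [ht₇ 0 (by omega), Function.update_apply, hs₅.r4, ht₅ 0 (by omega), ht₄ 0 (by omega)]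
  have h9₇ : s₇.num (.reg 9) = M + r := by rw [hf₇.num 9 (by decide)]; simp
  have hb₇ : s₇.dat (.reg 2) = none := (hf₇'.dat 2 (by decide)).trans hb
  refine (runs_fixPath hB hs₇ hb₇ hX h9₇ (by omega) (by omega) (by omega) ?_).weaken ?_
  · intro u hu huM hne
    rw [hT₇]
    exact heapAt_update (hh u hu huM) (by omega) hne
  rintro s₈ ⟨hf₈, hl₈, hh₈, ht₈⟩
  refine ⟨hf₇'.trans hf₈ (by simp) (by simp), ?_, ?_, hh₈, insert r D, ?_, ?_, ?_⟩
  · rw [hf₈.num 8 (by decide), hf₇.num 8 (by decide)]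
    simp [hf₅.num 8 (by decide), h8₄]
  · intro τ hτ h1 x
    rw [ht₈ τ hτ (by omega), ht₇ τ hτ]
    simp [show τ ≠ 0 by omega, ht₅ τ hτ, h1.ne', ht₄ τ hτ, ht τ hτ h1]
  · rw [Finset.card_insert_of_notMem r2, hD]
  · intro r' hr'
    rw [hl₈, hT₇, Function.update_apply, hl r' hr']
    by_cases h : r' = r <;> simp [h]
  · have e3 : s₈.dat (.reg 3) = s₄.dat (.reg 3) := by
      rw [hf₈.dat 3 (by decide), hf₇.dat 3 (by decide)]
      simp [hf₅.dat 3 (by decide)]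
    have e16 : s₈.num (.reg 16) = s₄.num (.reg 16) := by
      rw [hf₈.num 16 (by decide), hf₇.num 16 (by decide)]
      simp [hf₅.num 16 (by decide)]
    rw [e3, e16]
    apply hE₄
    intro r'
    rw [ht₈ 1 (by omega) one_pos, ht₇ 1 (by omega)]
    simp [ht₅ 1 (by omega), h17₄, ht₄ 1 (by omega)]

theorem runs_extract {L : ℕ} (hB : Cap B C X) (hs : Ctx C m M inp s)
    (hb : s.dat (.reg 2) = none) (hX : 2 * M + 1 ≤ X) (hM : inp M = none)
    (hinp : ∀ r < M, inp r ≠ none) (hL : 2 * M ≤ 2 ^ (L + 1))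
    (hl : ∀ r < M, tab C s 0 (M + r) = r)
    (hh : ∀ u, 1 ≤ u → u < M → HeapAt inp (tab C s 0) u) :
    Runs B extract (2 + (M * (20 * L + 19 + 1) + 1)) (fun s' =>
      Frame [8, 9, 10, 11, 13, 14, 15, 16, 17] [0, 1, 3] s s' ∧
      (∀ τ < C, 1 < τ → ∀ x, tab C s' τ x = tab C s τ x) ∧
      (∀ r < M, tab C s' 1 r ≤ M) ∧
      ∀ r < M, ∀ r' < M, tab C s' 1 r = tab C s' 1 r' ↔ inp r = inp r') s := by
  refine Runs.seq (Runs.blk (by simp [FitsAll, Instr.Fits]) ?_)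
  refine Runs.weaken (Runs.loop (ExtractInv C M inp s) M ?_ ?_ ?_) ?_
  · intro i hi s₁ hinv
    refine ⟨?_, runs_extractStep hB hs hb hX hM hinp hL hi hinv⟩
    have hs₁ := hs.frame hinv.1 (by decide)
    simpa [Test.Holds, hs₁.r4, hinv.2.1]
  · intro s₁ hinv
    have hs₁ := hs.frame hinv.1 (by decide)
    simp [Test.Holds, hs₁.r4, hinv.2.1]
  -- With nothing extracted and the counter at 0 the conditions are trivial, whatever data register
  -- 3 contains.
  · exact ⟨((Frame.refl s).setNum (by decide) _).setNum (by decide) _, by simp, by simp,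
      fun u h1 h2 => by simpa [HeapAt] using hh u h1 h2, ∅, rfl, by simpa using hl,
      by constructor <;> simp⟩
  · rintro s' ⟨hf, -, ht, -, D, hD, -, hE⟩
    have hDM : D = Finset.range M := Finset.eq_of_subset_of_card_le hE.subset (by simp [hD])
    have hmem : ∀ r < M, r ∈ D := fun r hr => by simpa [hDM] using hr
    exact ⟨hf, ht, fun r hr => (hE.id_le r (hmem r hr)).trans (hE.cnt_le.trans hD.le),
      fun r hr r' hr' => hE.id_eq r (hmem r hr) r' (hmem r' hr')⟩

end Extract

/-! ### Integer codes of projections of rows -/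

section Codes

variable {V : Type*} [LinearOrder V] {B C m M X : ℕ} {inp : ℕ → Option V} {s : State V}

/-- The polynomial code of the entries of row `ρ` in the columns `l`. -/
def codeVal (m M : ℕ) (ID : ℕ → ℕ) (ρ : ℕ) : List ℕ → ℕ
  | [] => 0
  | c :: l => codeVal m M ID ρ l * (M + 1) + ID ((ρ - 1) * m + c)

/-- Compute the code of the columns `l` of the row in register `x` into register `12`. -/
def code (x : ℕ) : List ℕ → Prog
  | [] => blk [.const 12 0]
  | c :: l => .seq (code x l) (.seq (blk [.sub 13 x 1, .mul 13 13 3, .const 11 c, .add 13 13 11])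
      (.seq (blk (rd 1 13 14)) (blk [.mul 12 12 5, .add 12 12 14])))

theorem codeVal_lt {ID : ℕ → ℕ} {ρ : ℕ} {l : List ℕ} (h : ∀ c ∈ l, ID ((ρ - 1) * m + c) ≤ M) :
    codeVal m M ID ρ l < (M + 1) ^ l.length := by
  induction l with
  | nil => simp [codeVal]
  | cons c l ih =>
    have h1 := ih fun c hc => h c (by simp [hc])
    have h2 := h c (by simp)
    rw [codeVal, List.length_cons, pow_succ]
    nlinarith

/-- Uniqueness of digits in base `M + 1`, as identifiers are at most `M`. Equality of projections
thus becomes equality of two numbers. -/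
theorem codeVal_eq_iff {ID : ℕ → ℕ} {ρ ρ' : ℕ} {l : List ℕ}
    (h : ∀ c ∈ l, ID ((ρ - 1) * m + c) ≤ M) (h' : ∀ c ∈ l, ID ((ρ' - 1) * m + c) ≤ M) :
    codeVal m M ID ρ l = codeVal m M ID ρ' l ↔
      ∀ c ∈ l, ID ((ρ - 1) * m + c) = ID ((ρ' - 1) * m + c) := by
  induction l with
  | nil => simp [codeVal]
  | cons c l ih =>
    rw [codeVal, codeVal, addr_inj (Nat.lt_succ_of_le (h c (by simp)))
      (Nat.lt_succ_of_le (h' c (by simp))),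
      ih (fun c hc => h c (by simp [hc])) fun c hc => h' c (by simp [hc])]
    simp

/-- Horner's rule from the end of the list. The intermediate codes belong to tails of `l`, so `hX`
keeps them within the word bound too. -/
theorem runs_code {x ρ : ℕ} {l : List ℕ} (hB : Cap B C X) (hs : Ctx C m M inp s)
    (hX : (M + 1) ^ l.length ≤ X) (hMX : M ≤ X) (hx : x ∉ [10, 11, 12, 13, 14])
    (hρ : s.num (.reg x) = ρ) (hl : ∀ c ∈ l, (ρ - 1) * m + c < M)
    (hID : ∀ r < M, tab C s 1 r ≤ M) :
    Runs B (code x l) (10 * l.length + 1) (fun s' => Frame [10, 11, 12, 13, 14] [] s s' ∧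
      (∀ τ < C, ∀ x, tab C s' τ x = tab C s τ x) ∧
      s'.num (.reg 12) = codeVal m M (tab C s 1) ρ l) s := by
  have hC := hB.two_le
  induction l with
  | nil =>
    exact Runs.blk (by simp [FitsAll, Instr.Fits])
      ⟨(Frame.refl s).setNum (by decide) _, by simp, by simp [codeVal]⟩
  | cons c l ih =>
    rw [List.length_cons, pow_succ] at hX
    have hX' : (M + 1) ^ l.length ≤ X := le_trans (Nat.le_mul_of_pos_right _ (by omega)) hX
    have hc := hl c (by simp)
    have hMB := hB.idx hMX
    refine Runs.mono (t := 10 * l.length + 1 + (4 + (4 + 2)))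
      (Runs.seq ((ih hX' fun c hc => hl c (by simp [hc])).weaken ?_))
      (by simp; omega) fun _ h => h
    rintro s₁ ⟨hf₁, ht₁, h12⟩
    have hs₁ := hs.frame hf₁ (by decide)
    have hx₁ : s₁.num (.reg x) = ρ := (hf₁.num x hx).trans hρ
    simp only [List.mem_cons, List.not_mem_nil, or_false, not_or] at hx
    refine Runs.seq (Runs.blk ?_ ?_)
    · simp [FitsAll, Instr.Fits, hx₁, hs₁.r1, hs₁.r3]
      omega
    simp only [List.foldl_cons, List.foldl_nil, apply_sub, apply_mul, apply_const, apply_add]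
    generalize hs₂d : State.setNum (State.setNum (State.setNum (State.setNum s₁ _ _) _ _) _ _) _ _
      = s₂
    have hs₂ : Ctx C m M inp s₂ := hs₂d ▸ (((hs₁.setNum (by decide) _).setNum (by decide)
      _).setNum (by decide) _).setNum (by decide) _
    have hf₂ : Frame [10, 11, 12, 13, 14] [] s s₂ := hs₂d ▸ (((hf₁.setNum (by decide)
      _).setNum (by decide) _).setNum (by decide) _).setNum (by decide) _
    have h13 : s₂.num (.reg 13) = (ρ - 1) * m + c := by simp [← hs₂d, hx₁, hs₁.r1, hs₁.r3]
    have h12₂ : s₂.num (.reg 12) = codeVal m M (tab C s 1) ρ l := by simp [← hs₂d, h12]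
    have ht₂ : ∀ τ < C, ∀ x, tab C s₂ τ x = tab C s τ x := fun τ hτ x => by
      simpa [← hs₂d] using ht₁ τ hτ x
    refine Runs.seq ((runs_rd (τ := 1) (x := 13) (d := 14) hB hs₂ (by omega) (by omega)).weaken ?_)
    rintro s₃ ⟨hf₃, h14, ht₃⟩
    have hs₃ := hs₂.frame hf₃ (by decide)
    have h12₃ : s₃.num (.reg 12) = codeVal m M (tab C s 1) ρ l :=
      (hf₃.num 12 (by decide)).trans h12₂
    rw [h13, ht₂ 1 (by omega)] at h14
    have e1 := codeVal_lt (m := m) (M := M) (ID := tab C s 1) (ρ := ρ) (l := l)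
      fun c hc => hID _ (hl c (by simp [hc]))
    have e2 := hID _ hc
    have e3 := hB.idx hX
    refine Runs.blk ?_ ⟨?_, ?_, ?_⟩
    · simp [FitsAll, Instr.Fits, h12₃, hs₃.r5, h14]
      constructor <;> nlinarith
    · exact ((hf₂.trans hf₃ (by simp) (by simp)).setNum (by decide) _).setNum (by decide) _
    · intro τ hτ x
      simp [ht₃ τ hτ, ht₂ τ hτ]
    · simp [h12₃, hs₃.r5, h14, codeVal]

end Codes

/-! ### Linked lists of representatives, sorted by separator code -/

section Lists

variable {V : Type*} [LinearOrder V] {B C m M X : ℕ} {inp : ℕ → Option V} {s : State V}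

/-- The linked list with links `nxt` that starts in `h` consists of the entries of `l`. -/
def IsChain (nxt : ℕ → ℕ) : ℕ → List ℕ → Prop
  | h, [] => h = 0
  | h, x :: l => h = x ∧ x ≠ 0 ∧ IsChain nxt (nxt x) l

theorem IsChain.congr {nxt nxt' : ℕ → ℕ} {h : ℕ} {l : List ℕ} (hl : IsChain nxt h l)
    (e : ∀ x ∈ l, nxt' x = nxt x) : IsChain nxt' h l := by
  induction l generalizing h with
  | nil => exact hl
  | cons x l ih =>
    exact ⟨hl.1, hl.2.1, by rw [e x (by simp)]; exact ih hl.2.2 fun y hy => e y (by simp [hy])⟩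

/-- The first rows among the rows `1, …, n` with their `cB`-code, in the order of decreasing
numbers, restricted to those with `cS`-code `c`. -/
def group (cB cS : ℕ → ℕ) (c : ℕ) : ℕ → List ℕ
  | 0 => []
  | n + 1 => if cS (n + 1) = c ∧ ∀ ρ, 1 ≤ ρ → ρ ≤ n → cB ρ ≠ cB (n + 1) then
      (n + 1) :: group cB cS c n else group cB cS c n

/-- Each class of rows with equal `cB`-code is represented by its smallest member only; this is what
later excludes duplicates. -/
theorem mem_group {cB cS : ℕ → ℕ} {c n ρ : ℕ} : ρ ∈ group cB cS c n ↔
    1 ≤ ρ ∧ ρ ≤ n ∧ cS ρ = c ∧ ∀ ρ', 1 ≤ ρ' → ρ' < ρ → cB ρ' ≠ cB ρ := by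
  induction n with
  | zero => simp [group]; omega
  | succ n ih =>
    rw [group]
    split_ifs with h
    · rw [List.mem_cons, ih]
      constructor
      · rintro (rfl | ⟨h1, h2, h3⟩)
        · exact ⟨by omega, le_rfl, h.1, fun ρ' h1 h2 => h.2 ρ' h1 (by omega)⟩
        · exact ⟨h1, by omega, h3⟩
      · rintro ⟨h1, h2, h3⟩
        rcases h2.eq_or_lt with rfl | h2
        · exact Or.inl rfl
        · exact Or.inr ⟨h1, by omega, h3⟩
    · rw [ih]
      constructor
      · rintro ⟨h1, h2, h3⟩
        exact ⟨h1, by omega, h3⟩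
      · rintro ⟨h1, h2, h3⟩
        rcases h2.eq_or_lt with rfl | h2
        · exact absurd ⟨h3.1, fun ρ' h1 h2 => h3.2 ρ' h1 (by omega)⟩ h
        · exact ⟨h1, by omega, h3⟩

theorem nodup_group {cB cS : ℕ → ℕ} {c n : ℕ} : (group cB cS c n).Nodup := by
  induction n with
  | zero => simp [group]
  | succ n ih =>
    rw [group]
    split_ifs
    · exact List.nodup_cons.2 ⟨fun h => by have := mem_group.1 h; omega, ih⟩
    · exact ih

/-- Process the row in register `8` for the bag with number `j` and columns `lB`, and the separator
with columns `lS`. -/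
def buildRow (j : ℕ) (lB lS : List ℕ) : Prog :=
  .seq (blk [.add 8 8 1]) (.seq (code 8 lB) (.seq (blk [.copy 15 12]) (.seq (code 8 lS)
    (.seq (blk (rd (2 + 3 * j) 15 16)) (.ite (.eqNum 16 7)
      (.seq (blk (wr (2 + 3 * j) 15 1)) (.seq (blk (rd (3 + 3 * j) 12 16))
        (.seq (blk (wr (4 + 3 * j) 8 16)) (blk (wr (3 + 3 * j) 12 8))))) .skip)))))

/-- Build the linked lists for a bag. -/
def buildBag (j : ℕ) (lB lS : List ℕ) : Prog :=
  .seq (blk [.const 8 0]) (.loop (.ltNum 8 0) (buildRow j lB lS))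

/-- The linked lists of bag `j` for the first `n` rows. -/
def ListsBuilt (C j : ℕ) (cB cS : ℕ → ℕ) (n : ℕ) (s : State V) : Prop :=
  ∀ c, IsChain (tab C s (4 + 3 * j)) (tab C s (3 + 3 * j) c) (group cB cS c n)

/-- The state after processing `n` rows for bag `j`. -/
def BuildInv (C j : ℕ) (cB cS : ℕ → ℕ) (s₀ : State V) (n : ℕ) (s : State V) : Prop :=
  Frame [8, 10, 11, 12, 13, 14, 15, 16] [] s₀ s ∧ s.num (.reg 8) = n ∧
  (∀ τ < C, τ ≠ 2 + 3 * j → τ ≠ 3 + 3 * j → τ ≠ 4 + 3 * j → ∀ x, tab C s τ x = tab C s₀ τ x) ∧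
  (∀ c, tab C s (2 + 3 * j) c = 0 ↔ ∀ ρ, 1 ≤ ρ → ρ ≤ n → cB ρ ≠ c) ∧
  ListsBuilt C j cB cS n s

/-- The flag at the bag code tells whether an earlier row has the same bag projection. If not, the
row is put in front of the list for its separator code: its link receives the old head, and the row
becomes the new head. -/
theorem runs_buildRow {j n N : ℕ} {lB lS : List ℕ} {s₀ : State V} (hB : Cap B C X)
    (hs₀ : Ctx C m M inp s₀) (hXB : (M + 1) ^ lB.length ≤ X) (hXS : (M + 1) ^ lS.length ≤ X)
    (hMX : M ≤ X) (hNX : N ≤ X) (hMN : M = N * m) (hlB : ∀ c ∈ lB, c < m) (hlS : ∀ c ∈ lS, c < m)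
    (hID : ∀ r < M, tab C s₀ 1 r ≤ M) (hj : 5 + 3 * j ≤ C) (hn : n < N)
    (hinv : BuildInv C j (codeVal m M (tab C s₀ 1) · lB) (codeVal m M (tab C s₀ 1) · lS) s₀ n s) :
    Runs B (buildRow j lB lS) (10 * (lB.length + lS.length) + 25)
      (BuildInv C j (codeVal m M (tab C s₀ 1) · lB) (codeVal m M (tab C s₀ 1) · lS) s₀ (n + 1))
      s := by
  have hC := hB.two_le
  obtain ⟨hf, h8, ht, hseen, hlist⟩ := hinv
  have hs := hs₀.frame hf (by decide)
  have hcell : ∀ c < m, (n + 1 - 1) * m + c < M := by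
    intro c hc
    rw [hMN, Nat.add_sub_cancel]
    calc n * m + c < (n + 1) * m := by rw [Nat.succ_mul]; omega
      _ ≤ N * m := Nat.mul_le_mul_right _ hn
  have hnB := hB.idx hNX
  set cB : ℕ → ℕ := (codeVal m M (tab C s₀ 1) · lB) with hcB
  set cS : ℕ → ℕ := (codeVal m M (tab C s₀ 1) · lS) with hcS
  have hid : ∀ s' : State V, (∀ τ < C, ∀ x, tab C s' τ x = tab C s τ x) →
      tab C s' 1 = tab C s₀ 1 := by
    intro s' h
    funext x
    rw [h 1 (by omega), ht 1 (by omega) (by omega) (by omega) (by omega)]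
  refine Runs.mono (t := 1 + ((10 * lB.length + 1) + (1 + ((10 * lS.length + 1) +
    (4 + (1 + max (4 + (4 + (4 + 4))) 0))))))
    (Runs.seq (Runs.blk ?_ ?_)) (by norm_num; omega) (fun _ h => h)
  · simp [FitsAll, Instr.Fits, h8, hs.r1]
    omega
  simp only [List.foldl_cons, List.foldl_nil, apply_add, h8, hs.r1]
  have hs₁ := hs.setNum (d := 8) (by decide) (n + 1)
  have hf₁ := hf.setNum (d := 8) (by decide) (n + 1)
  have ht₁ : ∀ τ < C, ∀ x, tab C (s.setNum (.reg 8) (n + 1)) τ x = tab C s τ x := by simp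
  refine Runs.seq ((runs_code (ρ := n + 1) hB hs₁ hXB hMX (by decide) (by simp)
    (fun c hc => hcell c (hlB c hc)) (by rw [hid _ ht₁]; exact hID)).weaken ?_)
  rintro s₂ ⟨hf₂, ht₂, h12⟩
  rw [hid _ ht₁] at h12
  have ht₂ : ∀ τ < C, ∀ x, tab C s₂ τ x = tab C s τ x := fun τ hτ x => by
    rw [ht₂ τ hτ, ht₁ τ hτ]
  have hs₂ := hs₁.frame hf₂ (by decide)
  have hf₂' := hf₁.trans hf₂ (by simp) (by simp)
  have h8₂ : s₂.num (.reg 8) = n + 1 := by rw [hf₂.num 8 (by decide)]; simp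
  refine Runs.seq (Runs.blk (by simp [FitsAll, Instr.Fits]) ?_)
  simp only [List.foldl_cons, List.foldl_nil, apply_copy, h12]
  have hs₃ := hs₂.setNum (d := 15) (by decide) (cB (n + 1))
  have hf₃ := hf₂'.setNum (d := 15) (by decide) (cB (n + 1))
  have ht₃ : ∀ τ < C, ∀ x, tab C (s₂.setNum (.reg 15) (cB (n + 1))) τ x = tab C s τ x := by
    simpa using ht₂
  refine Runs.seq ((runs_code (ρ := n + 1) hB hs₃ hXS hMX (by decide) (by simpa using h8₂)
    (fun c hc => hcell c (hlS c hc)) (by rw [hid _ ht₃]; exact hID)).weaken ?_)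
  rintro s₄ ⟨hf₄, ht₄, h12₄⟩
  rw [hid _ ht₃] at h12₄
  have ht₄ : ∀ τ < C, ∀ x, tab C s₄ τ x = tab C s τ x := fun τ hτ x => by
    rw [ht₄ τ hτ, ht₃ τ hτ]
  have hs₄ := hs₃.frame hf₄ (by decide)
  have hf₄' := hf₃.trans hf₄ (by simp) (by simp)
  have h8₄ : s₄.num (.reg 8) = n + 1 := by rw [hf₄.num 8 (by decide)]; simpa using h8₂
  have h15₄ : s₄.num (.reg 15) = cB (n + 1) := by rw [hf₄.num 15 (by decide)]; simp
  have hcBX : cB (n + 1) ≤ X := le_trans (codeVal_lt fun c hc => hID _ (hcell c (hlB c hc))).le hXB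
  have hcSX : cS (n + 1) ≤ X := le_trans (codeVal_lt fun c hc => hID _ (hcell c (hlS c hc))).le hXS
  refine Runs.seq ((runs_rd (τ := 2 + 3 * j) (x := 15) (d := 16) hB hs₄ (by omega)
    (by omega)).weaken ?_)
  rintro s₅ ⟨hf₅, h16, ht₅⟩
  have ht₅ : ∀ τ < C, ∀ x, tab C s₅ τ x = tab C s τ x := fun τ hτ x => by
    rw [ht₅ τ hτ, ht₄ τ hτ]
  rw [h15₄, ht₄ _ (by omega)] at h16
  have hs₅ := hs₄.frame hf₅ (by decide)
  have hf₅' := hf₄'.trans hf₅ (by simp) (by simp)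
  have h8₅ : s₅.num (.reg 8) = n + 1 := by rw [hf₅.num 8 (by decide), h8₄]
  have h12₅ : s₅.num (.reg 12) = cS (n + 1) := by rw [hf₅.num 12 (by decide), h12₄]
  have h15₅ : s₅.num (.reg 15) = cB (n + 1) := by rw [hf₅.num 15 (by decide), h15₄]
  refine Runs.ite (fun h => ?_) fun h => Runs.skip ?_
  · simp only [Test.Holds, h16, hs₅.r7, hseen] at h
    refine Runs.seq ((runs_wr (τ := 2 + 3 * j) (x := 15) (y := 1) hB hs₅ (by omega) (by omega)
      (by decide)).weaken ?_)
    rintro s₆ ⟨hf₆, ht₆⟩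
    rw [h15₅, hs₅.r1] at ht₆
    have hs₆ := hs₅.frame hf₆ (by decide)
    have hf₆' := hf₅'.trans hf₆ (by simp) (by simp)
    have h8₆ : s₆.num (.reg 8) = n + 1 := by rw [hf₆.num 8 (by decide), h8₅]
    have h12₆ : s₆.num (.reg 12) = cS (n + 1) := by rw [hf₆.num 12 (by decide), h12₅]
    refine Runs.seq ((runs_rd (τ := 3 + 3 * j) (x := 12) (d := 16) hB hs₆ (by omega)
      (by omega)).weaken ?_)
    rintro s₇ ⟨hf₇, h16₇, ht₇⟩
    rw [h12₆, ht₆ _ (by omega), if_neg (by omega), ht₅ _ (by omega)] at h16₇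
    have hs₇ := hs₆.frame hf₇ (by decide)
    have hf₇' := hf₆'.trans hf₇ (by simp) (by simp)
    have h8₇ : s₇.num (.reg 8) = n + 1 := by rw [hf₇.num 8 (by decide), h8₆]
    have h12₇ : s₇.num (.reg 12) = cS (n + 1) := by rw [hf₇.num 12 (by decide), h12₆]
    refine Runs.seq ((runs_wr (τ := 4 + 3 * j) (x := 8) (y := 16) hB hs₇ (by omega) (by omega)
      (by decide)).weaken ?_)
    rintro s₈ ⟨hf₈, ht₈⟩
    rw [h8₇, h16₇] at ht₈
    have hs₈ := hs₇.frame hf₈ (by decide)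
    have hf₈' := hf₇'.trans hf₈ (by simp) (by simp)
    have h8₈ : s₈.num (.reg 8) = n + 1 := by rw [hf₈.num 8 (by decide), h8₇]
    have h12₈ : s₈.num (.reg 12) = cS (n + 1) := by rw [hf₈.num 12 (by decide), h12₇]
    refine (runs_wr (τ := 3 + 3 * j) (x := 12) (y := 8) hB hs₈ (by omega) (by omega)
      (by decide)).weaken ?_
    rintro s₉ ⟨hf₉, ht₉⟩
    rw [h8₈, h12₈] at ht₉
    have hT : ∀ τ < C, ∀ x, tab C s₉ τ x =
        if τ = 3 + 3 * j ∧ x = cS (n + 1) then n + 1 else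
        if τ = 4 + 3 * j ∧ x = n + 1 then tab C s (3 + 3 * j) (cS (n + 1)) else
        if τ = 2 + 3 * j ∧ x = cB (n + 1) then 1 else tab C s τ x := by
      intro τ hτ x
      rw [ht₉ τ hτ, ht₈ τ hτ, ht₇ τ hτ, ht₆ τ hτ, ht₅ τ hτ]
    refine ⟨hf₈'.trans hf₉ (by simp) (by simp), ?_, ?_, ?_, ?_⟩
    · rw [hf₉.num 8 (by decide), h8₈]
    · intro τ hτ h1 h2 h3 x
      rw [hT τ hτ, if_neg (by omega), if_neg (by omega), if_neg (by omega), ht τ hτ h1 h2 h3]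
    · intro c
      rw [hT _ (by omega), if_neg (by omega), if_neg (by omega)]
      by_cases hc : c = cB (n + 1)
      · rw [if_pos ⟨rfl, hc⟩]
        exact iff_of_false one_ne_zero fun h => h (n + 1) (by omega) le_rfl hc.symm
      · rw [if_neg (by tauto), hseen]
        constructor
        · intro h ρ h1 h2
          rcases h2.eq_or_lt with rfl | h2
          · exact Ne.symm hc
          · exact h ρ h1 (by omega)
        · intro h ρ h1 h2
          exact h ρ h1 (by omega)
    · intro c
      -- The new link is stored at `n + 1`, while the old lists contain only rows up to `n`.
      have hold : IsChain (tab C s₉ (4 + 3 * j)) (tab C s (3 + 3 * j) c) (group cB cS c n) := by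
        refine (hlist c).congr fun x hx => ?_
        have := mem_group.1 hx
        rw [hT _ (by omega), if_neg (by omega), if_neg (by omega), if_neg (by omega)]
      rw [group, hT _ (by omega)]
      by_cases hc : cS (n + 1) = c
      · subst hc
        rw [if_pos ⟨rfl, rfl⟩, if_pos ⟨rfl, h⟩]
        refine ⟨rfl, by omega, ?_⟩
        rw [hT _ (by omega), if_neg (by omega), if_pos ⟨rfl, rfl⟩]
        exact hold
      · rw [if_neg (by tauto), if_neg (by omega), if_neg (by omega), if_neg (by tauto)]
        exact hold
  · simp only [Test.Holds, h16, hs₅.r7] at h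
    refine ⟨hf₅', h8₅, ?_, ?_, ?_⟩
    · intro τ hτ h1 h2 h3 x
      rw [ht₅ τ hτ, ht τ hτ h1 h2 h3]
    · intro c
      rw [ht₅ _ (by omega), hseen]
      constructor
      · intro h' ρ h1 h2 h3
        rcases h2.eq_or_lt with rfl | h2
        · subst h3
          exact h ((hseen _).2 h')
        · exact h' ρ h1 (by omega) h3
      · intro h ρ h1 h2
        exact h ρ h1 (by omega)
    · intro c
      rw [group, if_neg (by rw [hseen] at h; tauto), ht₅ _ (by omega)]
      exact (hlist c).congr fun x _ => ht₅ _ (by omega) x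

/-- By `hz` all flags, heads and links are zero at the start: no code has been seen and all lists
are empty. So tables with polynomially many addresses cost no initialisation, and the time is linear
in `N`. -/
theorem runs_buildBag {j N : ℕ} {lB lS : List ℕ} (hB : Cap B C X)
    (hs : Ctx C m M inp s) (h0 : s.num (.reg 0) = N) (hXB : (M + 1) ^ lB.length ≤ X)
    (hXS : (M + 1) ^ lS.length ≤ X) (hMX : M ≤ X) (hNX : N ≤ X) (hMN : M = N * m)
    (hlB : ∀ c ∈ lB, c < m) (hlS : ∀ c ∈ lS, c < m)
    (hID : ∀ r < M, tab C s 1 r ≤ M) (hj : 5 + 3 * j ≤ C)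
    (hz : ∀ τ < C, 2 + 3 * j ≤ τ → ∀ x, tab C s τ x = 0) :
    Runs B (buildBag j lB lS) (1 + (N * (10 * (lB.length + lS.length) + 25 + 1) + 1))
      (fun s' => Frame [8, 10, 11, 12, 13, 14, 15, 16] [] s s' ∧
        (∀ τ < C, τ ≠ 2 + 3 * j → τ ≠ 3 + 3 * j → τ ≠ 4 + 3 * j →
          ∀ x, tab C s' τ x = tab C s τ x) ∧
        ListsBuilt C j (codeVal m M (tab C s 1) · lB) (codeVal m M (tab C s 1) · lS) N s') s := by
  refine Runs.seq (Runs.blk (by simp [FitsAll, Instr.Fits]) ?_)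
  refine Runs.weaken (Runs.loop (BuildInv C j (codeVal m M (tab C s 1) · lB)
    (codeVal m M (tab C s 1) · lS) s) N ?_ ?_ ?_) ?_
  · intro i hi s₁ hinv
    refine ⟨?_, runs_buildRow hB hs hXB hXS hMX hNX hMN hlB hlS hID hj hi hinv⟩
    simpa [Test.Holds, hinv.1.num 0 (by decide), h0, hinv.2.1]
  · intro s₁ hinv
    simp [Test.Holds, hinv.1.num 0 (by decide), h0, hinv.2.1]
  · refine ⟨(Frame.refl s).setNum (by decide) _, by simp, by simp, ?_, ?_⟩
    · intro c
      simp [hz (2 + 3 * j) (by omega) le_rfl]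
      omega
    · intro c
      simp [group, IsChain, hz (3 + 3 * j) (by omega) (by omega)]
  · rintro s' ⟨h1, -, h2, -, h3⟩
    exact ⟨h1, h2, h3⟩

end Lists

/-- The part of the query and the decomposition that the programs depend on: for each of the `k`
bags, listed such that parents precede their children, the columns `lB` of the bag, the columns `lS`
of its separator and the number `p` of its parent; and for each of the `m` columns the number `o` of
some bag with that column. -/
structure Layout where
  k : ℕ
  m : ℕ
  lB : ℕ → List ℕ
  lS : ℕ → List ℕ
  p : ℕ → ℕ
  o : ℕ → ℕ
  separator_zero : lS 0 = []
  p_lt : ∀ j < k, 0 < j → p j < j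
  separator_subset : ∀ j < k, lS j ⊆ lB j
  bag_lt : ∀ j < k, ∀ c ∈ lB j, c < m
  separator_parent : ∀ j < k, ∀ c ∈ lS j, c ∈ lB (p j)
  mem_separator : ∀ j < k, ∀ i < j, ∀ c ∈ lB j, c ∈ lB i → c ∈ lS j
  o_lt : ∀ c < m, o c < k
  o_mem : ∀ c < m, c ∈ lB (o c)

namespace Layout

/-- The number of tables. -/
def C (P : Layout) : ℕ := 2 + 3 * P.k

/-- Move to the first tuple of bag `j` that matches the current tuple of the parent bag. -/
def descend (P : Layout) (j : ℕ) : Prog :=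
  .seq (code (20 + P.p j) (P.lS j)) (blk (rd (3 + 3 * j) 12 (20 + j)))

/-- Move to the next combination of tuples of the first `j` bags. -/
def adv (P : Layout) : ℕ → Prog
  | 0 => blk [.const 6 0]
  | j + 1 => .seq (blk (rd (4 + 3 * j) (20 + j) 16)) (.ite (.eqNum 16 7)
      (.seq (P.adv j) (P.descend j)) (blk [.copy (20 + j) 16]))

/-- Move to the first combination of tuples of the first `j` bags. -/
def descendAll (P : Layout) : ℕ → Prog
  | 0 => .skip
  | j + 1 => .seq (P.descendAll j) (P.descend j)

/-- Output the first `c` columns of the current tuple. -/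
def outAll (P : Layout) : ℕ → Prog
  | 0 => .skip
  | c + 1 => .seq (P.outAll c)
      (blk [.sub 13 (20 + P.o c) 1, .mul 13 13 3, .const 11 c, .add 13 13 11, .loadDat c 13])

/-- The enumeration program. -/
def next (P : Layout) : Prog :=
  .ite (.eqNum 6 7) (blk [.const 0 0])
    (.seq (P.outAll P.m) (.seq (P.adv P.k) (blk [.const 0 1])))

/-- Time for `descend`. -/
def descendTime (P : Layout) (j : ℕ) : ℕ := 10 * (P.lS j).length + 1 + 4

/-- Time for `adv`. -/
def advTime (P : Layout) : ℕ → ℕ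
  | 0 => 1
  | j + 1 => 4 + (1 + max (P.advTime j + P.descendTime j) 1)

/-- Time for `descendAll`. -/
def descendAllTime (P : Layout) : ℕ → ℕ
  | 0 => 0
  | j + 1 => P.descendAllTime j + P.descendTime j

end Layout

/-- The contents `tb` of the tables describe the lists of the bags for a relation with `N` rows. -/
structure Built (P : Layout) (N : ℕ) (tb : ℕ → ℕ → ℕ) : Prop where
  id_le : ∀ r < N * P.m, tb 1 r ≤ N * P.m
  chain : ∀ j < P.k, ∀ c, IsChain (tb (4 + 3 * j)) (tb (3 + 3 * j) c)
    (group (codeVal P.m (N * P.m) (tb 1) · (P.lB j)) (codeVal P.m (N * P.m) (tb 1) · (P.lS j)) c N)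

/-- The matching tuples of bag `j` if row `ρ` is chosen for the parent bag. -/
def children (P : Layout) (N : ℕ) (tb : ℕ → ℕ → ℕ) (j ρ : ℕ) : List ℕ :=
  group (codeVal P.m (N * P.m) (tb 1) · (P.lB j)) (codeVal P.m (N * P.m) (tb 1) · (P.lS j))
    (codeVal P.m (N * P.m) (tb 1) ρ (P.lS j)) N

theorem cell_lt {N m ρ c : ℕ} (h1 : 1 ≤ ρ) (hN : ρ ≤ N) (hc : c < m) :
    (ρ - 1) * m + c < N * m := by
  obtain ⟨ρ, rfl⟩ : ∃ ρ', ρ = ρ' + 1 := ⟨ρ - 1, by omega⟩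
  calc (ρ + 1 - 1) * m + c < (ρ + 1) * m := by rw [Nat.succ_mul, Nat.add_sub_cancel]; omega
    _ ≤ N * m := Nat.mul_le_mul_right _ hN

/-! ### Combinations of matching rows and what remains of them -/

section Enumeration

variable {P : Layout} {N : ℕ} {tb : ℕ → ℕ → ℕ}

theorem mem_children {j ρ x : ℕ} (h : x ∈ children P N tb j ρ) : 1 ≤ x ∧ x ≤ N :=
  ⟨(mem_group.1 h).1, (mem_group.1 h).2.1⟩

/-- The separator of the root bag is empty, so its candidates do not depend on a parent. This makes
the arbitrary value `P.p 0` harmless. -/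
theorem children_zero (ρ ρ' : ℕ) : children P N tb 0 ρ = children P N tb 0 ρ' := by
  simp [children, P.separator_zero, codeVal]

/-- The first row with the same bag projection as `ρ` is a match: it agrees with `ρ` on the bag,
hence on the separator. This is why the enumeration has no dead ends. -/
theorem children_ne_nil (hT : Built P N tb) {j ρ : ℕ} (hj : j < P.k) (hρ : 1 ≤ ρ) (hN : ρ ≤ N) :
    children P N tb j ρ ≠ [] := by
  classical
  set cB : ℕ → ℕ := (codeVal P.m (N * P.m) (tb 1) · (P.lB j)) with hcB
  have hex : ∃ x, 1 ≤ x ∧ x ≤ N ∧ cB x = cB ρ := ⟨ρ, hρ, hN, rfl⟩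
  obtain ⟨h1, h2, h3⟩ := Nat.find_spec hex
  refine List.ne_nil_of_mem (a := Nat.find hex) (mem_group.2 ⟨h1, h2, ?_, ?_⟩)
  · have hle : ∀ x, 1 ≤ x → x ≤ N → ∀ c ∈ P.lB j, tb 1 ((x - 1) * P.m + c) ≤ N * P.m :=
      fun x h1 h2 c hc => hT.id_le _ (cell_lt h1 h2 (P.bag_lt j hj c hc))
    have h := (codeVal_eq_iff (hle _ h1 h2) (hle _ hρ hN)).1 h3
    exact (codeVal_eq_iff (fun c hc => hle _ h1 h2 c (P.separator_subset j hj hc))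
      fun c hc => hle _ hρ hN c (P.separator_subset j hj hc)).2
      fun c hc => h c (P.separator_subset j hj hc)
  · intro x hx1 hx2 hx3
    exact Nat.find_min hex hx2 ⟨hx1, by omega, hx3.trans h3⟩

/-- The extensions by a tuple of bag `j` of a combination `x` of tuples of the previous bags. -/
def extend (P : Layout) (N : ℕ) (tb : ℕ → ℕ → ℕ) (j : ℕ) (x : List ℕ) : List (List ℕ) :=
  (children P N tb j (x.getD (P.p j) 0)).map (x ++ [·])

/-- All combinations of matching tuples of the first `j` bags. -/
def combos (P : Layout) (N : ℕ) (tb : ℕ → ℕ → ℕ) : ℕ → List (List ℕ)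
  | 0 => [[]]
  | j + 1 => (combos P N tb j).flatMap (extend P N tb j)

/-- The first `j` entries of `cur`. -/
def pref (cur : ℕ → ℕ) (j : ℕ) : List ℕ := (List.range j).map cur

theorem pref_succ (cur : ℕ → ℕ) (j : ℕ) : pref cur (j + 1) = pref cur j ++ [cur j] := by
  simp [pref, List.range_succ]

theorem pref_congr {cur cur' : ℕ → ℕ} {j : ℕ} (h : ∀ i < j, cur i = cur' i) :
    pref cur j = pref cur' j :=
  List.map_congr_left fun i hi => h i (List.mem_range.1 hi)

theorem pref_getD {cur : ℕ → ℕ} {j i : ℕ} (h : i < j) : (pref cur j).getD i 0 = cur i := by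
  simp [pref, List.getD, h]

theorem extend_pref {cur : ℕ → ℕ} {j : ℕ} (hj : j < P.k) :
    extend P N tb j (pref cur j) =
      (children P N tb j (cur (P.p j))).map (pref cur j ++ [·]) := by
  rcases Nat.eq_zero_or_pos j with rfl | h
  · rw [extend, children_zero]
  · rw [extend, pref_getD (P.p_lt j hj h)]

/-- The entries of `cur` for the first `j` bags match. -/
def Valid (P : Layout) (N : ℕ) (tb : ℕ → ℕ → ℕ) (j : ℕ) (cur : ℕ → ℕ) : Prop :=
  ∀ i < j, cur i ∈ children P N tb i (cur (P.p i))

/-- The combinations that follow `cur` in the enumeration are `rest`. -/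
def Pend (P : Layout) (N : ℕ) (tb : ℕ → ℕ → ℕ) : ℕ → (ℕ → ℕ) → List (List ℕ) → Prop
  | 0, _, rest => rest = []
  | j + 1, cur, rest => ∃ tl rest', IsChain (tb (4 + 3 * j)) (tb (4 + 3 * j) (cur j)) tl ∧
      tl ⊆ children P N tb j (cur (P.p j)) ∧ Pend P N tb j cur rest' ∧
      rest = tl.map (pref cur j ++ [·]) ++ rest'.flatMap (extend P N tb j)

theorem Valid.congr {cur cur' : ℕ → ℕ} {j : ℕ} (hj : j ≤ P.k) (h : Valid P N tb j cur)
    (e : ∀ i < j, cur' i = cur i) : Valid P N tb j cur' := by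
  intro i hi
  rcases Nat.eq_zero_or_pos i with rfl | h0
  · rw [children_zero _ (cur (P.p 0)), e 0 hi]
    exact h 0 hi
  · rw [e i hi, e (P.p i) (by have := P.p_lt i (by omega) h0; omega)]
    exact h i hi

theorem Pend.congr {cur cur' : ℕ → ℕ} {j : ℕ} {rest : List (List ℕ)} (hj : j ≤ P.k)
    (h : Pend P N tb j cur rest) (e : ∀ i < j, cur' i = cur i) : Pend P N tb j cur' rest := by
  induction j generalizing rest with
  | zero => exact h
  | succ j ih =>
    obtain ⟨tl, rest', h1, h2, h3, h4⟩ := h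
    refine ⟨tl, rest', by rwa [e j (by omega)], ?_,
      ih (by omega) h3 fun i hi => e i (by omega), ?_⟩
    · rcases Nat.eq_zero_or_pos j with rfl | h0
      · rwa [children_zero _ (cur (P.p 0))]
      · rwa [e (P.p j) (by have := P.p_lt j (by omega) h0; omega)]
    · rw [h4, pref_congr fun i hi => e i (by omega)]

/-- Appending the first matching tuple of bag `j`. -/
theorem chain_descend (hT : Built P N tb) (hN : 1 ≤ N) {j : ℕ} (hj : j < P.k) {cur : ℕ → ℕ}
    (hv : Valid P N tb j cur)
    (hc : cur j = tb (3 + 3 * j) (codeVal P.m (N * P.m) (tb 1) (cur (P.p j)) (P.lS j))) :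
    ∃ tl, children P N tb j (cur (P.p j)) = cur j :: tl ∧
      IsChain (tb (4 + 3 * j)) (tb (4 + 3 * j) (cur j)) tl := by
  have h := hT.chain j hj (codeVal P.m (N * P.m) (tb 1) (cur (P.p j)) (P.lS j))
  rw [← hc] at h
  change IsChain _ _ (children P N tb j (cur (P.p j))) at h
  have hne : children P N tb j (cur (P.p j)) ≠ [] := by
    rcases Nat.eq_zero_or_pos j with rfl | h0
    · rw [children_zero _ 1]
      exact children_ne_nil hT hj le_rfl hN
    · have := mem_children (hv (P.p j) (P.p_lt j hj h0))
      exact children_ne_nil hT hj this.1 this.2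
  obtain ⟨y, tl, e⟩ := List.exists_cons_of_ne_nil hne
  rw [e] at h ⊢
  obtain ⟨rfl, -, h⟩ := h
  exact ⟨tl, rfl, h⟩

end Enumeration

/-! ### The odometer on the machine -/

section Machine

variable {V : Type*} {B X N : ℕ} {P : Layout} {inp : ℕ → Option V}
  {tb : ℕ → ℕ → ℕ} {s : State V}

/-- The registers with constants and the tables contain what they should. -/
structure Ready (P : Layout) (N : ℕ) (inp : ℕ → Option V) (tb : ℕ → ℕ → ℕ) (s : State V) :
    Prop where
  ctx : Ctx P.C P.m (N * P.m) inp s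
  tabs : ∀ τ < P.C, ∀ x, tab P.C s τ x = tb τ x

theorem Ready.frame {Y Z : List ℕ} {s' : State V} (h : Ready P N inp tb s) (hf : Frame Y Z s s')
    (hY : ∀ i ∈ [1, 2, 3, 4, 5, 7, 18], i ∉ Y)
    (ht : ∀ τ < P.C, ∀ x, tab P.C s' τ x = tab P.C s τ x) : Ready P N inp tb s' :=
  ⟨h.ctx.frame hf hY, fun τ hτ x => (ht τ hτ x).trans (h.tabs τ hτ x)⟩

variable [LinearOrder V]

/-- The bound `X` on the indices of tables is large enough. -/
structure Room (P : Layout) (N X : ℕ) : Prop where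
  rows : N ≤ X
  nodes : 2 * (N * P.m) + 1 ≤ X
  codes : ∀ j < P.k, (N * P.m + 1) ^ (P.lB j).length ≤ X
  sepCodes : ∀ j < P.k, (N * P.m + 1) ^ (P.lS j).length ≤ X

/-- The rows currently chosen for the bags. -/
def cur (s : State V) (i : ℕ) : ℕ := s.num (.reg (20 + i))

/-- The separator code of the row chosen at the parent is the address of the head of the list of
matches. The cost depends only on the length of the separator. -/
theorem runs_descend {j : ℕ} (hB : Cap B P.C X) (hR : Room P N X) (hs : Ready P N inp tb s)
    (hT : Built P N tb) (hj : j < P.k) (hv : Valid P N tb j (cur s)) :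
    Runs B (P.descend j) (P.descendTime j) (fun s' =>
      Frame [10, 11, 12, 13, 14, 20 + j] [] s s' ∧ Ready P N inp tb s' ∧
      cur s' j = tb (3 + 3 * j) (codeVal P.m (N * P.m) (tb 1) (cur s (P.p j)) (P.lS j))) s := by
  have hC : P.C = 2 + 3 * P.k := rfl
  have hn := hR.nodes
  have e1 : tab P.C s 1 = tb 1 := funext fun x => hs.tabs 1 (by omega) x
  have hcell : ∀ c ∈ P.lS j, (cur s (P.p j) - 1) * P.m + c < N * P.m := by
    intro c hc
    rcases Nat.eq_zero_or_pos j with rfl | h0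
    · simp [P.separator_zero] at hc
    · have := mem_children (hv (P.p j) (P.p_lt j hj h0))
      exact cell_lt this.1 this.2 (P.bag_lt j hj c (P.separator_subset j hj hc))
  refine Runs.seq ((runs_code (x := 20 + P.p j) (ρ := cur s (P.p j)) hB hs.ctx (hR.sepCodes j hj)
    (by omega) (by simp; omega) rfl hcell (by rw [e1]; exact hT.id_le)).weaken ?_)
  rintro s₁ ⟨hf₁, ht₁, h12⟩
  rw [e1] at h12
  have hs₁ := hs.frame hf₁ (by decide) ht₁
  have hX : codeVal P.m (N * P.m) (tb 1) (cur s (P.p j)) (P.lS j) ≤ X :=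
    le_trans (codeVal_lt fun c hc => hT.id_le _ (hcell c hc)).le (hR.sepCodes j hj)
  refine (runs_rd (τ := 3 + 3 * j) (x := 12) (d := 20 + j) hB hs₁.ctx (by omega)
    (by omega)).weaken ?_
  rintro s₂ ⟨hf₂, hd, ht₂⟩
  refine ⟨(hf₁.mono (by simp) (by simp)).trans hf₂ (by simp) (by simp),
    hs₁.frame hf₂ (by simp; omega) ht₂, ?_⟩
  rw [cur, hd, hs₁.tabs _ (by omega), h12]

/-- The number registers changed when moving among the first `j` bags. -/
def advRegs (j : ℕ) : List ℕ := [6, 10, 11, 12, 13, 14, 16] ++ (List.range j).map (20 + ·)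

theorem advRegs_subset {i j : ℕ} (h : i ≤ j) : advRegs i ⊆ advRegs j := by
  intro x
  simp only [advRegs, List.mem_append, List.mem_map, List.mem_range]
  rintro (hx | ⟨y, hy, rfl⟩)
  · exact Or.inl hx
  · exact Or.inr ⟨y, by omega, rfl⟩

theorem descendRegs_subset {j : ℕ} : [10, 11, 12, 13, 14, 20 + j] ⊆ advRegs (j + 1) := by
  intro x hx
  simp only [List.mem_cons, List.not_mem_nil, or_false] at hx
  rcases hx with rfl | rfl | rfl | rfl | rfl | rfl <;> simp [advRegs]

theorem advRegs_ctx {j : ℕ} : ∀ i ∈ [1, 2, 3, 4, 5, 7, 18], i ∉ advRegs j := by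
  intro i hi
  simp only [List.mem_cons, List.not_mem_nil, or_false] at hi
  simp only [advRegs, List.mem_append, List.mem_cons, List.not_mem_nil, or_false, List.mem_map,
    List.mem_range, not_or, not_exists, not_and]
  refine ⟨by omega, fun x _ => by omega⟩

/-- In this odometer the last bag turns fastest. A zero link means that its list is exhausted; then
the previous bags advance and the last one is reset to its first match. On overflow register 6
becomes 0, but the resets still take place, which is harmless and keeps the choice valid. -/
theorem runs_adv {j : ℕ} {rest : List (List ℕ)} (hB : Cap B P.C X) (hR : Room P N X)
    (hs : Ready P N inp tb s) (hT : Built P N tb) (hN : 1 ≤ N) (hj : j ≤ P.k)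
    (hv : Valid P N tb j (cur s)) (hp : Pend P N tb j (cur s) rest) :
    Runs B (P.adv j) (P.advTime j) (fun s' =>
      Frame (advRegs j) [] s s' ∧ Ready P N inp tb s' ∧ Valid P N tb j (cur s') ∧
      ((rest = [] ∧ s'.num (.reg 6) = 0) ∨ ∃ rest', rest = pref (cur s') j :: rest' ∧
        Pend P N tb j (cur s') rest' ∧ s'.num (.reg 6) = s.num (.reg 6))) s := by
  have hC : P.C = 2 + 3 * P.k := rfl
  induction j generalizing rest s with
  | zero =>
    have hf : Frame (advRegs 0) [] s (s.setNum (.reg 6) 0) :=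
      (Frame.refl s).setNum (by simp [advRegs]) _
    exact Runs.blk (by simp [FitsAll, Instr.Fits])
      ⟨hf, hs.frame hf advRegs_ctx (by simp), by simp [Valid], Or.inl ⟨hp, by simp⟩⟩
  | succ j ih =>
    obtain ⟨tl, rest', c1, c2, c3, rfl⟩ := hp
    have hvj : Valid P N tb j (cur s) := fun i hi => hv i (by omega)
    have hcur := mem_children (hv j (by omega))
    have hrow := hR.rows
    refine Runs.seq ((runs_rd (τ := 4 + 3 * j) (x := 20 + j) (d := 16) hB hs.ctx (by omega)
      (by change cur s j ≤ X; omega)).weaken ?_)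
    rintro s₁ ⟨hf₁, h16, ht₁⟩
    rw [hs.tabs _ (by omega)] at h16
    change _ = tb (4 + 3 * j) (cur s j) at h16
    have hs₁ := hs.frame hf₁ (by decide) ht₁
    have hcur₁ : ∀ i, cur s₁ i = cur s i := fun i => hf₁.num _ (by simp; omega)
    have hf₁' : Frame (advRegs (j + 1)) [] s s₁ := hf₁.mono (by simp [advRegs]) (by simp)
    have hvj₁ := hvj.congr (by omega) fun i _ => hcur₁ i
    refine Runs.ite (fun h => ?_) fun h => ?_
    · simp only [Test.Holds, hs₁.ctx.r7, h16] at h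
      obtain rfl : tl = [] := by
        cases tl with
        | nil => rfl
        | cons y tl => exact absurd (c1.1.symm.trans h) c1.2.1
      simp only [List.map_nil, List.nil_append]
      refine Runs.seq ((ih hs₁ (by omega) hvj₁ (c3.congr (by omega) fun i _ => hcur₁ i)).weaken ?_)
      rintro s₂ ⟨hf₂, hs₂, hv₂, hor⟩
      refine (runs_descend hB hR hs₂ hT (by omega) hv₂).weaken ?_
      rintro s₃ ⟨hf₃, hs₃, hd⟩
      have hcur₃ : ∀ i < j, cur s₃ i = cur s₂ i := fun i hi => hf₃.num _ (by simp; omega)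
      have hv₃ := hv₂.congr (by omega) hcur₃
      have hd' : cur s₃ j =
          tb (3 + 3 * j) (codeVal P.m (N * P.m) (tb 1) (cur s₃ (P.p j)) (P.lS j)) := by
        rcases Nat.eq_zero_or_pos j with rfl | h0
        · simpa [P.separator_zero, codeVal] using hd
        · rw [hcur₃ _ (P.p_lt j (by omega) h0), hd]
      obtain ⟨tl, e, hch⟩ := chain_descend hT hN (by omega) hv₃ hd'
      have h6 : s₃.num (.reg 6) = s₂.num (.reg 6) := hf₃.num 6 (by simp; omega)
      refine ⟨(hf₁'.trans hf₂ (advRegs_subset (by omega)) (by simp)).trans hf₃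
        descendRegs_subset (by simp), hs₃, ?_, ?_⟩
      · intro i hi
        rcases Nat.lt_succ_iff_lt_or_eq.1 hi with hi | rfl
        · exact hv₃ i hi
        · rw [e]
          simp
      · rcases hor with ⟨rfl, h0⟩ | ⟨rest'', rfl, hp, h0⟩
        · exact Or.inl ⟨rfl, h6.trans h0⟩
        · refine Or.inr ⟨tl.map (pref (cur s₃) j ++ [·]) ++ rest''.flatMap (extend P N tb j), ?_,
            ⟨tl, rest'', hch, by rw [e]; simp, hp.congr (by omega) hcur₃, rfl⟩, ?_⟩
          · rw [← pref_congr hcur₃, List.flatMap_cons, extend_pref (by omega), e, pref_succ]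
            rfl
          · rw [h6, h0, hf₁.num 6 (by decide)]
    · simp only [Test.Holds, hs₁.ctx.r7, h16] at h
      cases tl with
      | nil => exact absurd c1 h
      | cons y tl =>
        obtain ⟨e, y0, c1⟩ := c1
        refine Runs.mono (t := 1) (Runs.blk (by simp [FitsAll, Instr.Fits]) ?_) le_rfl
          fun _ h => h
        simp only [List.foldl_cons, List.foldl_nil, apply_copy, h16, e]
        generalize hs₂d : s₁.setNum _ _ = s₂
        have hf₂ : Frame (advRegs (j + 1)) [] s s₂ := by
          rw [← hs₂d]
          exact hf₁'.setNum (by simp [advRegs]) _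
        have hcur₂ : ∀ i < j, cur s₂ i = cur s i := fun i hi => by
          rw [← hs₂d]
          simpa [cur, hi.ne] using hcur₁ i
        have hcur₂j : cur s₂ j = y := by simp [← hs₂d, cur]
        have hs₂ : Ready P N inp tb s₂ := by
          refine hs.frame hf₂ advRegs_ctx fun τ hτ x => ?_
          rw [← hs₂d]
          simpa using ht₁ τ hτ x
        have hp : children P N tb j (cur s₂ (P.p j)) = children P N tb j (cur s (P.p j)) := by
          rcases Nat.eq_zero_or_pos j with rfl | h0
          · rw [children_zero]
          · rw [hcur₂ _ (P.p_lt j (by omega) h0)]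
        refine ⟨hf₂, hs₂, ?_, Or.inr ⟨tl.map (pref (cur s) j ++ [·]) ++
          rest'.flatMap (extend P N tb j), ?_, ⟨tl, rest', ?_, ?_, ?_, ?_⟩, ?_⟩⟩
        · intro i hi
          rcases Nat.lt_succ_iff_lt_or_eq.1 hi with hi | rfl
          · exact hvj.congr (by omega) hcur₂ i hi
          · rw [hcur₂j, hp]
            exact c2 (by simp)
        · rw [pref_succ, hcur₂j, pref_congr hcur₂]
          rfl
        · rwa [hcur₂j]
        · rw [hp]
          exact fun z hz => c2 (by simp [hz])
        · exact c3.congr (by omega) hcur₂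
        · rw [pref_congr hcur₂]
        · rw [← hs₂d]
          simp [hf₁.num 6, show 6 ≠ 20 + j by omega]

theorem runs_descendAll {j : ℕ} (hB : Cap B P.C X) (hR : Room P N X)
    (hs : Ready P N inp tb s) (hT : Built P N tb) (hN : 1 ≤ N) (hj : j ≤ P.k) :
    Runs B (P.descendAll j) (P.descendAllTime j) (fun s' =>
      Frame (advRegs j) [] s s' ∧ Ready P N inp tb s' ∧ Valid P N tb j (cur s') ∧
      ∃ rest, combos P N tb j = pref (cur s') j :: rest ∧ Pend P N tb j (cur s') rest) s := by
  induction j with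
  | zero => exact Runs.skip ⟨Frame.refl s, hs, by simp [Valid], [], rfl, rfl⟩
  | succ j ih =>
    refine Runs.seq ((ih (by omega)).weaken ?_)
    rintro s₂ ⟨hf₂, hs₂, hv₂, rest, hr, hp⟩
    refine (runs_descend hB hR hs₂ hT (by omega) hv₂).weaken ?_
    rintro s₃ ⟨hf₃, hs₃, hd⟩
    have hcur₃ : ∀ i < j, cur s₃ i = cur s₂ i := fun i hi => hf₃.num _ (by simp; omega)
    have hv₃ := hv₂.congr (by omega) hcur₃
    have hd' : cur s₃ j =
        tb (3 + 3 * j) (codeVal P.m (N * P.m) (tb 1) (cur s₃ (P.p j)) (P.lS j)) := by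
      rcases Nat.eq_zero_or_pos j with rfl | h0
      · simpa [P.separator_zero, codeVal] using hd
      · rw [hcur₃ _ (P.p_lt j (by omega) h0), hd]
    obtain ⟨tl, e, hch⟩ := chain_descend hT hN (by omega) hv₃ hd'
    refine ⟨(hf₂.mono (advRegs_subset (by omega)) (by simp)).trans hf₃
      descendRegs_subset (by simp), hs₃, ?_, ?_⟩
    · intro i hi
      rcases Nat.lt_succ_iff_lt_or_eq.1 hi with hi | rfl
      · exact hv₃ i hi
      · rw [e]
        simp
    · refine ⟨tl.map (pref (cur s₃) j ++ [·]) ++ rest.flatMap (extend P N tb j), ?_,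
        ⟨tl, rest, hch, by rw [e]; simp, hp.congr (by omega) hcur₃, rfl⟩⟩
      rw [combos, hr, ← pref_congr hcur₃, List.flatMap_cons, extend_pref (by omega), e, pref_succ]
      rfl

/-- Column `i` is read from the row chosen for one bag `P.o i` that contains it; that the other bags
with this column would give the same value is shown in `Valid.row_eq`. -/
theorem runs_outAll {c : ℕ} (hB : Cap B P.C X) (hR : Room P N X) (hs : Ready P N inp tb s)
    (hv : Valid P N tb P.k (cur s)) (hc : c ≤ P.m) :
    Runs B (P.outAll c) (c * 5) (fun s' =>
      Frame [11, 13] (List.range c) s s' ∧ Ready P N inp tb s' ∧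
      ∀ i < c, s'.dat (.reg i) = inp ((cur s (P.o i) - 1) * P.m + i)) s := by
  induction c with
  | zero => exact Runs.skip ⟨Frame.refl s, hs, by simp⟩
  | succ c ih =>
    rw [Nat.succ_mul]
    refine Runs.seq ((ih (by omega)).weaken ?_)
    rintro s₁ ⟨hf₁, hs₁, h⟩
    have ho := mem_children (hv _ (P.o_lt c hc))
    have hcell := cell_lt ho.1 ho.2 hc
    have hn := hB.idx hR.nodes
    have hcur : s₁.num (.reg (20 + P.o c)) = cur s (P.o c) := hf₁.num _ (by simp; omega)
    refine Runs.blk ?_ ?_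
    · simp [FitsAll, Instr.Fits, hcur, hs₁.ctx.r1, hs₁.ctx.r3]
      omega
    · have hf₂ := ((((hf₁.mono (Y' := List.range (c + 1)) (List.Subset.refl _)
        (List.range_subset.2 (by omega))).setNum (d := 13) (by decide)
        (cur s (P.o c) - 1)).setNum (d := 13) (by decide)
        ((cur s (P.o c) - 1) * P.m)).setNum (d := 11) (by decide) c).setNum (d := 13) (by decide)
        ((cur s (P.o c) - 1) * P.m + c)
      have hf₃ := hf₂.setDat (d := c) (by simp) (inp ((cur s (P.o c) - 1) * P.m + c))
      simp [hcur, hs₁.ctx.r1, hs₁.ctx.r3, hs₁.ctx.data]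
      refine ⟨hf₃, ?_, ?_⟩
      · refine hs.frame hf₃ (by decide) fun τ hτ x => ?_
        rw [hs.tabs τ hτ x]
        simpa using hs₁.tabs τ hτ x
      · intro i hi
        rcases eq_or_ne i c with rfl | hne
        · simp
        · simpa [hne] using h i (by omega)

end Machine

/-! ## Programs that change only registers -/

/-- The instruction changes only registers below `w`. -/
def Instr.Within (w : ℕ) : Instr → Prop
  | .const d _ | .copy d _ | .add d _ _ | .sub d _ _ | .mul d _ _ | .div d _ _ | .load d _
  | .copyDat d _ | .loadDat d _ => d < w
  | .store _ _ | .storeDat _ _ => False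

/-- The program changes only registers below `w`. -/
def Prog.Within (w : ℕ) : Prog → Prop
  | .skip => True
  | .instr i => i.Within w
  | .seq p q => p.Within w ∧ q.Within w
  | .ite _ p q => p.Within w ∧ q.Within w
  | .loop _ p => p.Within w

/-- The registers below `w`. -/
def lowRegs (w : ℕ) : Finset Loc := (Finset.range w).image Loc.reg

section Within

variable {V : Type*} {w : ℕ}

theorem State.AgreeOutside.refl (W : Finset Loc) (s : State V) : s.AgreeOutside W s :=
  fun _ _ => ⟨rfl, rfl⟩

theorem State.AgreeOutside.trans {W : Finset Loc} {s s' s'' : State V} (h : s.AgreeOutside W s')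
    (h' : s'.AgreeOutside W s'') : s.AgreeOutside W s'' :=
  fun l hl => ⟨(h l hl).1.trans (h' l hl).1, (h l hl).2.trans (h' l hl).2⟩

theorem State.agreeOutside_setNum (s : State V) {d : ℕ} (hd : d < w) (v : ℕ) :
    (s.setNum (.reg d) v).AgreeOutside (lowRegs w) s := by
  intro l hl
  have : l ≠ .reg d := fun e => hl (by simpa [lowRegs, e] using hd)
  simp [this]

theorem State.agreeOutside_setDat (s : State V) {d : ℕ} (hd : d < w) (v : Option V) :
    (s.setDat (.reg d) v).AgreeOutside (lowRegs w) s := by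
  intro l hl
  have : l ≠ .reg d := fun e => hl (by simpa [lowRegs, e] using hd)
  simp [this]

theorem Instr.agreeOutside_apply {i : Instr} (hi : i.Within w) (s : State V) :
    (i.apply s).AgreeOutside (lowRegs w) s := by
  cases i with
  | const | copy | add | sub | mul | div | load => exact s.agreeOutside_setNum hi _
  | copyDat | loadDat => exact s.agreeOutside_setDat hi _
  | store | storeDat => exact hi.elim

/-- The locations that can change are read off the program text, so the space bound does not depend
on the run. -/
theorem Exec.agreeOutside [LinearOrder V] {p : Prog} {s s' : State V} {tr : List (State V)}
    (h : Exec p s tr s') (hp : p.Within w) :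
    (∀ st ∈ tr, st.AgreeOutside (lowRegs w) s) ∧ s'.AgreeOutside (lowRegs w) s := by
  induction h with
  | skip s => exact ⟨by simp, .refl _ _⟩
  | instr i s => exact ⟨by simpa using Instr.agreeOutside_apply hp s, i.agreeOutside_apply hp s⟩
  | seq _ _ ih ih' =>
    obtain ⟨h1, h2⟩ := ih hp.1
    obtain ⟨g1, g2⟩ := ih' hp.2
    refine ⟨fun st hst => ?_, g2.trans h2⟩
    rcases List.mem_append.1 hst with hst | hst
    · exact h1 st hst
    · exact (g1 st hst).trans h2
  | ite_true _ _ ih =>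
    obtain ⟨h1, h2⟩ := ih hp.1
    exact ⟨by simpa using ⟨.refl _ _, h1⟩, h2⟩
  | ite_false _ _ ih =>
    obtain ⟨h1, h2⟩ := ih hp.2
    exact ⟨by simpa using ⟨.refl _ _, h1⟩, h2⟩
  | loop_false _ => exact ⟨by simpa using .refl _ _, .refl _ _⟩
  | loop_true _ _ _ ih ih' =>
    obtain ⟨h1, h2⟩ := ih hp
    obtain ⟨g1, g2⟩ := ih' hp
    refine ⟨fun st hst => ?_, g2.trans h2⟩
    simp only [List.mem_cons, List.mem_append] at hst
    rcases hst with rfl | hst | hst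
    · exact .refl _ _
    · exact h1 st hst
    · exact (g1 st hst).trans h2

theorem within_blk {l : List Instr} : (blk l).Within w ↔ ∀ i ∈ l, i.Within w := by
  induction l with
  | nil => simp [blk, Prog.Within]
  | cons i l ih => simp [blk, Prog.Within, ih]

theorem within_code (hw : 20 ≤ w) (x : ℕ) (l : List ℕ) : (code x l).Within w := by
  induction l with
  | nil => simp [code, within_blk, Instr.Within]; omega
  | cons c l ih =>
    simp [code, Prog.Within, within_blk, ih, Instr.Within, rd]
    omega

theorem within_descend {P : Layout} {j : ℕ} (hw : 20 + j < w) : (P.descend j).Within w :=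
  ⟨within_code (by omega) _ _, by simp [within_blk, rd, Instr.Within]; omega⟩

theorem within_adv {P : Layout} {j : ℕ} (hw : 20 + j ≤ w) : (P.adv j).Within w := by
  induction j with
  | zero => simp [Layout.adv, within_blk, Instr.Within]; omega
  | succ j ih =>
    refine ⟨?_, ⟨ih (by omega), within_descend (by omega)⟩, ?_⟩
    · simp [within_blk, rd, Instr.Within]
      omega
    · simp [within_blk, Instr.Within]
      omega

theorem within_outAll {P : Layout} {c : ℕ} (hw : 20 + c ≤ w) : (P.outAll c).Within w := by
  induction c with
  | zero => trivial
  | succ c ih =>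
    refine ⟨ih (by omega), ?_⟩
    simp [within_blk, Instr.Within]
    omega

theorem within_next (P : Layout) : P.next.Within (20 + P.k + P.m) := by
  refine ⟨?_, within_outAll (by omega), within_adv (by omega), ?_⟩ <;>
    simp [within_blk, Instr.Within]

end Within

/-! ## The enumeration phase -/

section Next

variable {V : Type*} [LinearOrder V] {B X N : ℕ} {P : Layout} {inp : ℕ → Option V}
  {tb : ℕ → ℕ → ℕ} {s : State V}

/-- The combinations still to be reported are `pend`. -/
structure NextInv (P : Layout) (N : ℕ) (inp : ℕ → Option V) (tb : ℕ → ℕ → ℕ)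
    (pend : List (List ℕ)) (s : State V) : Prop where
  ready : Ready P N inp tb s
  flag : s.num (.reg 6) = 0 ∧ pend = [] ∨ s.num (.reg 6) = 1 ∧ 1 ≤ N ∧
    Valid P N tb P.k (cur s) ∧ ∃ rest, pend = pref (cur s) P.k :: rest ∧
    Pend P N tb P.k (cur s) rest

/-- Time for a call of `next`. -/
def Layout.nextTime (P : Layout) : ℕ := 1 + max 1 (P.m * 5 + (P.advTime P.k + 1))

theorem runs_next_nil (hs : NextInv P N inp tb [] s) :
    Runs B P.next P.nextTime (fun s' => s'.num (.reg 0) = 0) s := by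
  refine Runs.ite (fun _ => Runs.blk (by simp [FitsAll, Instr.Fits]) (by simp)) fun h => ?_
  obtain ⟨h6, -⟩ | ⟨-, -, -, rest, h, -⟩ := hs.flag
  · exact absurd (h6.trans hs.ready.ctx.r7.symm) h
  · simp at h

/-- The machine is one step ahead: the combination to be reported is already in the registers when
the call starts, and the call ends by preparing the following one. Moving on leaves the data
registers alone, so the output survives. -/
theorem runs_next_cons {x : List ℕ} {pend : List (List ℕ)} (hB : Cap B P.C X) (hR : Room P N X)
    (hT : Built P N tb) (hs : NextInv P N inp tb (x :: pend) s) :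
    Runs B P.next P.nextTime (fun s' => s'.num (.reg 0) = 1 ∧
      (∀ i < P.m, s'.dat (.reg i) = inp ((x.getD (P.o i) 0 - 1) * P.m + i)) ∧
      NextInv P N inp tb pend s') s := by
  obtain ⟨-, h⟩ | ⟨h6, hN, hv, rest, h, hp⟩ := hs.flag
  · simp at h
  obtain ⟨rfl, rfl⟩ := List.cons.inj h
  refine Runs.ite (fun h => ?_) fun _ => ?_
  · simp [Test.Holds, h6, hs.ready.ctx.r7] at h
  refine Runs.seq ((runs_outAll hB hR hs.ready hv le_rfl).weaken ?_)
  rintro s₁ ⟨hf₁, hs₁, hd⟩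
  have hcur₁ : ∀ i < P.k, cur s₁ i = cur s i := fun i _ => hf₁.num _ (by simp; omega)
  refine Runs.seq ((runs_adv hB hR hs₁ hT hN le_rfl (hv.congr le_rfl hcur₁)
    (hp.congr le_rfl hcur₁)).weaken ?_)
  rintro s₂ ⟨hf₂, hs₂, hv₂, hor⟩
  refine Runs.blk ?_ ?_
  · simp only [FitsAll, Instr.Fits, and_true]
    have := hR.nodes
    exact hB.idx (by omega)
  simp only [List.foldl_cons, List.foldl_nil, apply_const]
  have hf₃ : Frame [0] [] s₂ (s₂.setNum (.reg 0) 1) := (Frame.refl s₂).setNum (by simp) _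
  have hcur₃ : ∀ i < P.k, cur (s₂.setNum (.reg 0) 1) i = cur s₂ i := fun i _ => by
    simp [cur]
  refine ⟨by simp, fun i hi => ?_, hs₂.frame hf₃ (by decide) (by simp), ?_⟩
  · rw [State.dat_setNum, hf₂.dat i (by simp), hd i hi, pref_getD (P.o_lt i hi)]
  · rcases hor with ⟨h1, h2⟩ | ⟨rest', h1, h2, h3⟩
    · exact Or.inl ⟨by simpa using h2, h1⟩
    · refine Or.inr ⟨by simpa [h3] using (hf₁.num 6 (by decide)).trans h6, hN,
        hv₂.congr le_rfl hcur₃, rest', by rw [h1, pref_congr hcur₃], h2.congr le_rfl hcur₃⟩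

variable {α : Type*} {S : Finset α}

/-- The tuple that is reported for the combination `x`. -/
def tupleOf (P : Layout) (cols : Fin P.m ≃ S) (row : ℕ → Tuple S V) (x : List ℕ) : Tuple S V :=
  fun a => row (x.getD (P.o (cols.symm a)) 0) a

theorem Enumerates.mono {next : Prog} {m c c' : ℕ} {cols : Fin m ≃ S} {Ok : State V → Prop}
    {ts : List (Tuple S V)} (h : Enumerates next cols c Ok s ts) (hc : c ≤ c') :
    Enumerates next cols c' Ok s ts := by
  induction h with
  | done h1 h2 h3 h4 => exact .done h1 (h2.trans hc) h3 h4
  | more h1 h2 h3 h4 h5 _ ih => exact .more h1 (h2.trans hc) h3 h4 h5 ih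

theorem enumerates_next {cols : Fin P.m ≃ S} {row : ℕ → Tuple S V} {pend : List (List ℕ)}
    {s₀ : State V} (hB : Cap B P.C X) (hR : Room P N X) (hT : Built P N tb)
    (hrow : ∀ ρ, 1 ≤ ρ → ρ ≤ N → ∀ i : Fin P.m,
      inp ((ρ - 1) * P.m + i) = some (row ρ (cols i)))
    (hwb : s.WordBound B) (hagree : s.AgreeOutside (lowRegs (20 + P.k + P.m)) s₀)
    (hs : NextInv P N inp tb pend s) :
    Enumerates P.next cols P.nextTime (fun st => st.WordBound B ∧
      st.AgreeOutside (lowRegs (20 + P.k + P.m)) s₀) s (pend.map (tupleOf P cols row)) := by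
  induction pend generalizing s with
  | nil =>
    obtain ⟨tr, s', h1, h2, h3, -, h5⟩ := runs_next_nil (B := B) hs hwb
    exact .done h1 h2 (fun st hst => ⟨h3 st hst,
      ((h1.agreeOutside (within_next P)).1 st hst).trans hagree⟩) h5
  | cons x pend ih =>
    obtain ⟨tr, s', h1, h2, h3, h4, h5, h6, h7⟩ := runs_next_cons hB hR hT hs hwb
    have hag := h1.agreeOutside (within_next P)
    refine .more h1 h2 (fun st hst => ⟨h3 st hst, (hag.1 st hst).trans hagree⟩) h5 (fun j => ?_)
      (ih h4 (hag.2.trans hagree) h7)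
    rw [h6 j j.2]
    obtain ⟨-, h⟩ | ⟨-, -, hv, rest, h, -⟩ := hs.flag
    · simp at h
    · obtain ⟨rfl, -⟩ := List.cons.inj h
      have ho := P.o_lt j j.2
      have hm := mem_children (hv _ ho)
      rw [pref_getD ho, hrow _ hm.1 hm.2]
      simp only [tupleOf, Equiv.symm_apply_apply]
      rw [pref_getD ho]

end Next

/-! ## The preprocessing phase -/

section Pre

variable {V : Type*} [LinearOrder V] {B X N : ℕ} {P : Layout} {inp : ℕ → Option V}
  {tb : ℕ → ℕ → ℕ} {s : State V}

namespace Layout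

/-- Set up the registers with constants. -/
def setup (P : Layout) : Prog :=
  blk [.const 1 1, .const 2 P.C, .const 3 P.m, .mul 4 0 3, .add 5 4 1, .const 18 2]

/-- Build the lists for the first `j` bags. -/
def buildAll (P : Layout) : ℕ → Prog
  | 0 => .skip
  | j + 1 => .seq (P.buildAll j) (buildBag j (P.lB j) (P.lS j))

/-- Time for `buildAll` with `N` rows. -/
def buildAllTime (P : Layout) (N : ℕ) : ℕ → ℕ
  | 0 => 0
  | j + 1 => P.buildAllTime N j +
      (1 + (N * (10 * ((P.lB j).length + (P.lS j).length) + 25 + 1) + 1))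

/-- The preprocessing program. -/
def pre (P : Layout) : Prog :=
  .seq P.setup (.seq initLeaves (.seq buildTree (.seq extract (.seq (P.buildAll P.k)
    (.ite (.ltNum 7 0) (.seq (P.descendAll P.k) (blk [.const 6 1])) .skip)))))

end Layout

/-- Bag `j` writes only to its own three tables: lists built earlier stay intact and the tables of
later bags stay zero. -/
theorem runs_buildAll {j : ℕ} (hB : Cap B P.C X) (hR : Room P N X)
    (hs : Ctx P.C P.m (N * P.m) inp s) (h0 : s.num (.reg 0) = N)
    (hID : ∀ r < N * P.m, tab P.C s 1 r ≤ N * P.m)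
    (hz : ∀ τ < P.C, 1 < τ → ∀ x, tab P.C s τ x = 0) (hj : j ≤ P.k) :
    Runs B (P.buildAll j) (P.buildAllTime N j) (fun s' =>
      Frame [8, 10, 11, 12, 13, 14, 15, 16] [] s s' ∧
      (∀ x, tab P.C s' 1 x = tab P.C s 1 x) ∧
      (∀ τ < P.C, 2 + 3 * j ≤ τ → ∀ x, tab P.C s' τ x = 0) ∧
      ∀ i < j, ListsBuilt P.C i (codeVal P.m (N * P.m) (tab P.C s 1) · (P.lB i))
        (codeVal P.m (N * P.m) (tab P.C s 1) · (P.lS i)) N s') s := by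
  have hC : P.C = 2 + 3 * P.k := rfl
  induction j with
  | zero => exact Runs.skip ⟨Frame.refl s, fun _ => rfl, fun τ h1 h2 => hz τ h1 (by omega), by simp⟩
  | succ j ih =>
    refine Runs.seq ((ih (by omega)).weaken ?_)
    rintro s₁ ⟨hf₁, hid, hz₁, hl₁⟩
    have hs₁ := hs.frame hf₁ (by decide)
    have e1 : tab P.C s₁ 1 = tab P.C s 1 := funext hid
    have hn := hR.nodes
    refine (runs_buildBag (j := j) hB hs₁ ((hf₁.num 0 (by decide)).trans h0) (hR.codes j (by omega))
      (hR.sepCodes j (by omega)) (by omega) hR.rows rfl (P.bag_lt j (by omega))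
      (fun c hc => P.bag_lt j (by omega) c (P.separator_subset j (by omega) hc))
      (by rw [e1]; exact hID) (by omega) hz₁).weaken ?_
    rintro s₂ ⟨hf₂, ht₂, hl₂⟩
    rw [e1] at hl₂
    refine ⟨hf₁.trans hf₂ (by simp) (by simp), fun x => ?_, fun τ h1 h2 x => ?_, fun i hi => ?_⟩
    · rw [ht₂ 1 (by omega) (by omega) (by omega) (by omega), hid]
    · rw [ht₂ τ h1 (by omega) (by omega) (by omega), hz₁ τ h1 (by omega)]
    · rcases Nat.lt_succ_iff_lt_or_eq.1 hi with hi | rfl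
      · intro c
        rw [ht₂ _ (by omega) (by omega) (by omega) (by omega)]
        exact (hl₁ i hi c).congr fun x _ =>
          ht₂ _ (by omega) (by omega) (by omega) (by omega) x
      · exact hl₂

/-- Time for `pre` with `N` rows, where `L` bounds the depth of the tournament tree. -/
def Layout.preTime (P : Layout) (N L : ℕ) : ℕ :=
  6 + ((1 + (N * P.m * 7 + 1)) + ((1 + ((N * P.m - 1) * 20 + 1)) +
    ((2 + (N * P.m * (20 * L + 20) + 1)) + (P.buildAllTime N P.k +
      (1 + max (P.descendAllTime P.k + 1) 0)))))

/-- The cell just after the input is blank and serves as the sentinel of the tournament. The case `N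
= 0` is branched off because the first descent needs non-empty lists. -/
theorem runs_pre {L : ℕ} (hB : Cap B P.C X) (hR : Room P N X) (hm : P.m ≤ B)
    (h0 : s.num (.reg 0) = N) (hreg : ∀ i ≠ 0, s.num (.reg i) = 0)
    (hmem : ∀ a, s.num (.mem a) = 0) (hdat : ∀ i, s.dat (.reg i) = none)
    (hinp : ∀ a, s.dat (.mem a) = inp a) (hM : inp (N * P.m) = none)
    (hsome : ∀ r < N * P.m, inp r ≠ none) (hL : 2 * (N * P.m) ≤ 2 ^ (L + 1)) :
    Runs B P.pre (P.preTime N L) (fun s' => ∃ tb, Built P N tb ∧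
      (∀ r < N * P.m, ∀ r' < N * P.m, tb 1 r = tb 1 r' ↔ inp r = inp r') ∧
      NextInv P N inp tb (if N = 0 then [] else combos P N tb P.k) s') s := by
  have hC : P.C = 2 + 3 * P.k := rfl
  have hn := hR.nodes
  have hnB := hB.idx hn
  have hCB : P.C ≤ B := (Nat.le_mul_of_pos_left _ (Nat.succ_pos X)).trans hB.le
  have h2B : 2 ≤ B := hB.two_le.trans hCB
  refine Runs.seq (Runs.weaken (Q := fun s' => Ctx P.C P.m (N * P.m) inp s' ∧
    s'.num (.reg 0) = N ∧ s'.num (.reg 6) = 0 ∧ (∀ i, s'.dat (.reg i) = none) ∧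
    ∀ a, s'.num (.mem a) = 0) (Runs.blk ?_ ?_) ?_)
  · simp [FitsAll, Instr.Fits, h0]
    omega
  · simp only [List.foldl_cons, List.foldl_nil, apply_const, apply_mul, apply_add]
    refine ⟨by constructor <;> simp [h0, hreg, hinp], ?_⟩
    simp [h0, hreg, hdat, hmem]
  rintro s₁ ⟨hs₁, h0₁, h6₁, hd₁, hm₁⟩
  refine Runs.seq ((runs_initLeaves hB hs₁ hn).weaken ?_)
  rintro s₂ ⟨hf₂, hl₂, ht₂⟩
  have hs₂ := hs₁.frame hf₂ (by decide)
  refine Runs.seq ((runs_buildTree hB hs₂ ((hf₂.dat 2 (by decide)).trans (hd₁ 2)) hn).weaken ?_)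
  rintro s₃ ⟨hf₃, hl₃, hh₃, ht₃⟩
  have hs₃ := hs₂.frame hf₃ (by decide)
  refine Runs.seq ((runs_extract hB hs₃ ((hf₃.dat 2 (by decide)).trans
    ((hf₂.dat 2 (by decide)).trans (hd₁ 2))) hn hM hsome hL
    (fun r hr => (hl₃ r).trans (hl₂ r hr)) hh₃).weaken ?_)
  rintro s₄ ⟨hf₄, ht₄, hle₄, hid₄⟩
  have hs₄ := hs₃.frame hf₄ (by decide)
  have h0₄ : s₄.num (.reg 0) = N := by
    rw [hf₄.num 0 (by decide), hf₃.num 0 (by decide), hf₂.num 0 (by decide), h0₁]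
  have h6₄ : s₄.num (.reg 6) = 0 := by
    rw [hf₄.num 6 (by decide), hf₃.num 6 (by decide), hf₂.num 6 (by decide), h6₁]
  refine Runs.seq ((runs_buildAll hB hR hs₄ h0₄ hle₄ (fun τ hτ h x => ?_) le_rfl).weaken ?_)
  · rw [ht₄ τ hτ h, ht₃ τ hτ (by omega), ht₂ τ hτ (by omega)]
    exact hm₁ _
  rintro s₅ ⟨hf₅, hid₅, -, hb₅⟩
  have hs₅ := hs₄.frame hf₅ (by decide)
  have e1 : tab P.C s₅ 1 = tab P.C s₄ 1 := funext hid₅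
  have h0₅ : s₅.num (.reg 0) = N := by rw [hf₅.num 0 (by decide), h0₄]
  have h6₅ : s₅.num (.reg 6) = 0 := by rw [hf₅.num 6 (by decide), h6₄]
  have hready : Ready P N inp (tab P.C s₅) s₅ := ⟨hs₅, fun _ _ _ => rfl⟩
  have hbuilt : Built P N (tab P.C s₅) := by
    constructor
    · rw [e1]
      exact hle₄
    · rw [e1]
      exact hb₅
  refine Runs.ite (fun h => ?_) fun h => Runs.skip ?_
  · simp only [Test.Holds, hs₅.r7, h0₅] at h
    refine Runs.seq ((runs_descendAll hB hR hready hbuilt h le_rfl).weaken ?_)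
    rintro s₆ ⟨hf₆, hs₆, hv₆, rest, hr, hp⟩
    refine Runs.blk (by simp [FitsAll, Instr.Fits]; omega) ?_
    simp only [List.foldl_cons, List.foldl_nil, apply_const]
    have hf₇ : Frame [6] [] s₆ (s₆.setNum (.reg 6) 1) := (Frame.refl s₆).setNum (by simp) _
    have hcur : ∀ i < P.k, cur (s₆.setNum (.reg 6) 1) i = cur s₆ i := fun i _ =>
      hf₇.num _ (by simp; omega)
    refine ⟨tab P.C s₅, hbuilt, by rw [e1]; exact hid₄, hs₆.frame hf₇ (by decide) (by simp),
      Or.inr ⟨by simp, h, hv₆.congr le_rfl hcur, rest, ?_, hp.congr le_rfl hcur⟩⟩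
    rw [if_neg (by omega), hr, pref_congr hcur]
  · simp only [Test.Holds, hs₅.r7, h0₅] at h
    refine ⟨tab P.C s₅, hbuilt, by rw [e1]; exact hid₄, hready, Or.inl ⟨h6₅, ?_⟩⟩
    rw [if_pos (by omega)]

end Pre

/-! ## Ordering the bags -/

section Order

variable {N : Type*} {G : SimpleGraph N}

/-- On a shortest walk to `r`, every vertex other than the start `i` is strictly closer to `r` than
`i`. -/
theorem notMem_support_of_dist_le {r n i : N} {w : G.Walk i r} (hw : w.length = G.dist i r)
    (hle : G.dist i r ≤ G.dist n r) (hne : n ≠ i) : n ∉ w.support := by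
  classical
  intro hn
  have h1 := congrArg SimpleGraph.Walk.length (w.take_spec hn)
  rw [SimpleGraph.Walk.length_append] at h1
  have h2 := G.dist_le (w.dropUntil n hn)
  have h3 : (w.takeUntil n hn).length = 0 := by omega
  exact hne (SimpleGraph.Walk.eq_of_length_eq_zero h3).symm

/-- Every edge of a tree is a bridge. If `q` were outside `S`, one could go from `n` to `i` inside
`S`, then along a shortest walk to `r`, then back along a shortest walk to `q`. The first piece
misses `q` and the other two miss `n`, so the edge between `n` and `q` is never used, a
contradiction. -/
theorem parent_mem_of_induce_preconnected (hG : G.IsTree) {r n q i : N} {S : Set N}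
    (hS : (G.induce S).Preconnected) (hn : n ∈ S) (hi : i ∈ S) (hne : n ≠ i)
    (hle : G.dist i r ≤ G.dist n r) (hadj : G.Adj n q) (hq : G.dist q r < G.dist n r) : q ∈ S := by
  by_contra hqS
  have hbr := (SimpleGraph.isAcyclic_iff_forall_adj_isBridge.1 hG.isAcyclic) hadj
  rw [SimpleGraph.isBridge_iff_forall_walk_mem_edges] at hbr
  obtain ⟨w₁, h₁⟩ : ∃ w : G.Walk n i, q ∉ w.support := by
    obtain ⟨w⟩ := hS ⟨n, hn⟩ ⟨i, hi⟩
    refine ⟨w.map (SimpleGraph.Embedding.induce S).toHom, fun h => ?_⟩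
    obtain ⟨x, -, hx⟩ := List.mem_map.1 ((SimpleGraph.Walk.support_map _ w) ▸ h)
    exact hqS (hx ▸ x.2)
  obtain ⟨w₂, h₂⟩ := hG.connected.exists_walk_length_eq_dist i r
  obtain ⟨w₃, h₃⟩ := hG.connected.exists_walk_length_eq_dist q r
  have h := hbr ((w₁.append w₂).append w₃.reverse)
  rw [SimpleGraph.Walk.edges_append, List.mem_append, SimpleGraph.Walk.edges_append,
    List.mem_append, SimpleGraph.Walk.edges_reverse, List.mem_reverse] at h
  rcases h with (h | h) | h
  · exact h₁ (SimpleGraph.Walk.snd_mem_support_of_mem_edges _ h)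
  · exact notMem_support_of_dist_le h₂ hle hne
      (SimpleGraph.Walk.fst_mem_support_of_mem_edges _ h)
  · exact notMem_support_of_dist_le h₃ hq.le hadj.ne
      (SimpleGraph.Walk.fst_mem_support_of_mem_edges _ h)

variable {ι α : Type*} [Fintype ι] [DecidableEq α] [Finite N] {Q : JoinQuery ι α}

/-- The nodes can be listed such that the intersection of each bag with the previous ones is
contained in a single previous one. -/
theorem Decomposition.exists_order (T : Decomposition Q N) :
    ∃ (k : ℕ) (e : ℕ → N) (p : ℕ → ℕ), (∀ n, ∃ j < k, e j = n) ∧ ∀ j < k, 0 < j → p j < j ∧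
      ∀ i < j, ∀ a ∈ T.bag (e j), a ∈ T.bag (e i) → a ∈ T.bag (e (p j)) := by
  classical
  have := Fintype.ofFinite N
  obtain ⟨r⟩ := T.isTree.connected.nonempty
  let le : N → N → Prop := fun x y => T.tree.dist x r ≤ T.tree.dist y r
  have : Std.Total le := ⟨fun _ _ => Nat.le_total _ _⟩
  have : IsTrans N le := ⟨fun _ _ _ => Nat.le_trans⟩
  set l := Finset.univ.toList.insertionSort le with hl
  have hmem : ∀ n, n ∈ l := fun n => by simp [hl]
  have hnd : l.Nodup := (List.perm_insertionSort le _).nodup_iff.2 (Finset.nodup_toList _)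
  have hsort : l.Pairwise le := List.pairwise_insertionSort le _
  have hparent : ∀ n, n ≠ r → ∃ q, T.tree.Adj n q ∧ T.tree.dist q r < T.tree.dist n r := by
    intro n hn
    obtain ⟨w, hw⟩ := T.isTree.connected.exists_walk_length_eq_dist n r
    cases w with
    | nil => exact absurd rfl hn
    | cons h w =>
      refine ⟨_, h, ?_⟩
      have := T.tree.dist_le w
      rw [SimpleGraph.Walk.length_cons] at hw
      omega
  choose! q hadj hlt using hparent
  have hget : ∀ j (hj : j < l.length), l.getD j r = l[j] := fun j hj => by simp [hj]
  have hmono : ∀ i j, i < j → j < l.length → le (l.getD i r) (l.getD j r) := by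
    intro i j hij hj
    rw [hget i (by omega), hget j hj]
    exact List.pairwise_iff_getElem.1 hsort i j _ _ hij
  have hidx : ∀ n, l.idxOf n < l.length := fun n => List.idxOf_lt_length_of_mem (hmem n)
  have hgi : ∀ n, l.getD (l.idxOf n) r = n := fun n => by rw [hget _ (hidx n)]; simp
  refine ⟨l.length, fun j => l.getD j r, fun j => l.idxOf (q (l.getD j r)),
    fun n => ⟨l.idxOf n, hidx n, hgi n⟩, ?_⟩
  intro j hj h0
  set n := l.getD j r with hnj
  have hne : ∀ i < j, n ≠ l.getD i r := by
    intro i hi e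
    rw [hnj, hget j hj, hget i (by omega)] at e
    exact hi.ne' ((List.Nodup.getElem_inj_iff hnd).1 e)
  -- The first node in the list is at distance at most that of `n`. If `n` were the root, it would
  -- be the root as well and the list would repeat it.
  have hnr : n ≠ r := by
    intro e
    have h1 := hmono 0 j h0 hj
    have h2 : T.tree.dist (l.getD 0 r) r ≤ T.tree.dist n r := h1
    rw [e, SimpleGraph.dist_self, Nat.le_zero] at h2
    have := (T.isTree.connected.dist_eq_zero_iff).1 h2
    exact hne 0 h0 (e.trans this.symm)
  have hp : l.idxOf (q n) < j := by
    by_contra! h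
    have h1 : le n (q n) := by
      rcases h.eq_or_lt with h | h
      · have e : n = q n := by rw [← hgi (q n), ← h]
        exact (congrArg (T.tree.dist · r) e).le
      · have := hmono _ _ h (hidx _)
        rwa [hgi] at this
    have := hlt n hnr
    exact absurd h1 (by change ¬ T.tree.dist n r ≤ T.tree.dist (q n) r; omega)
  refine ⟨hp, fun i hi a ha hai => ?_⟩
  change a ∈ T.bag (l.getD (l.idxOf (q n)) r)
  rw [hgi]
  exact parent_mem_of_induce_preconnected (S := {n | a ∈ T.bag n}) T.isTree
    (T.connectivity a (T.bag_subset _ ha)).preconnected ha hai (hne i hi) (hmono i j hi hj)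
    (hadj n hnr) (hlt n hnr)

end Order

/-! ## The enumerated tuples -/

/-! ### Combinations correspond bijectively to result tuples -/

section Combos

variable {P : Layout} {N : ℕ} {tb : ℕ → ℕ → ℕ}

theorem mem_combos {j : ℕ} (hj : j ≤ P.k) {x : List ℕ} :
    x ∈ combos P N tb j ↔ x.length = j ∧ Valid P N tb j (x.getD · 0) := by
  induction j generalizing x with
  | zero => simp [combos, Valid]
  | succ j ih =>
    simp only [combos, List.mem_flatMap, extend, List.mem_map, ih (by omega : j ≤ P.k)]
    have hget : ∀ (y : List ℕ) (z : ℕ), y.length = j → ∀ i < j,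
        (y ++ [z]).getD i 0 = y.getD i 0 := fun y z hy i hi => by
      rw [List.getD_append _ _ _ _ (by omega)]
    have hlast : ∀ (y : List ℕ) (z : ℕ), y.length = j → (y ++ [z]).getD j 0 = z :=
      fun y z hy => by
        rw [List.getD_append_right _ _ _ _ (by omega)]
        simp [hy]
    have hchild : ∀ (y : List ℕ) (z : ℕ), y.length = j →
        children P N tb j ((y ++ [z]).getD (P.p j) 0) =
          children P N tb j (y.getD (P.p j) 0) := by
      intro y z hy
      rcases Nat.eq_zero_or_pos j with rfl | h0
      · exact children_zero _ _
      · rw [hget y z hy _ (P.p_lt j (by omega) h0)]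
    constructor
    · rintro ⟨y, ⟨hy, hv⟩, z, hz, rfl⟩
      refine ⟨by simp [hy], fun i hi => ?_⟩
      rcases Nat.lt_succ_iff_lt_or_eq.1 hi with hi | rfl
      · exact hv.congr (by omega) (hget y z hy) i hi
      · beta_reduce
        rw [hlast y z hy, hchild y z hy]
        exact hz
    · rintro ⟨hx, hv⟩
      obtain ⟨y, z, rfl⟩ : ∃ y z, x = y ++ [z] :=
        ⟨x.dropLast, x.getLast (by rintro rfl; simp at hx),
          (List.dropLast_append_getLast _).symm⟩
      have hy : y.length = j := by simpa using hx
      refine ⟨y, ⟨hy, ?_⟩, z, ?_, rfl⟩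
      · exact Valid.congr (by omega) (fun i hi => hv i (by omega)) fun i hi =>
          (hget y z hy i hi).symm
      · have := hv j (by omega)
        beta_reduce at this
        rwa [hlast y z hy, hchild y z hy] at this

theorem nodup_combos (j : ℕ) : (combos P N tb j).Nodup := by
  induction j with
  | zero => simp [combos]
  | succ j ih =>
    rw [combos, List.nodup_flatMap]
    refine ⟨fun x _ => nodup_group.map fun y z h => by simpa using h, ?_⟩
    refine ih.imp fun {x y} hxy => ?_
    simp only [Function.onFun, List.disjoint_left, extend, List.mem_map]
    rintro _ ⟨a, -, rfl⟩ ⟨b, -, h⟩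
    exact hxy (List.append_inj_left' h rfl).symm

theorem eq_pref_of_length {x : List ℕ} {j : ℕ} (h : x.length = j) : x = pref (x.getD · 0) j := by
  apply List.ext_getElem
  · simp [pref, h]
  · intro i h1 h2
    simp [pref, h1]

variable {V α : Type*} {S : Finset α} {cols : Fin P.m ≃ S} {row : ℕ → Tuple S V}

/-- Equality of identifiers is equality of data values. -/
def IdSpec (N : ℕ) (tb : ℕ → ℕ → ℕ) (cols : Fin P.m ≃ S) (row : ℕ → Tuple S V) : Prop :=
  ∀ ρ ρ', 1 ≤ ρ → ρ ≤ N → 1 ≤ ρ' → ρ' ≤ N → ∀ i : Fin P.m,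
    tb 1 ((ρ - 1) * P.m + i) = tb 1 ((ρ' - 1) * P.m + i) ↔ row ρ (cols i) = row ρ' (cols i)

theorem code_eq_iff (hT : Built P N tb) (hid : IdSpec N tb cols row) {ρ ρ' : ℕ} (h1 : 1 ≤ ρ)
    (hN : ρ ≤ N) (h1' : 1 ≤ ρ') (hN' : ρ' ≤ N) {l : List ℕ} (hl : ∀ c ∈ l, c < P.m) :
    codeVal P.m (N * P.m) (tb 1) ρ l = codeVal P.m (N * P.m) (tb 1) ρ' l ↔
      ∀ i : Fin P.m, (i : ℕ) ∈ l → row ρ (cols i) = row ρ' (cols i) := by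
  rw [codeVal_eq_iff (fun c hc => hT.id_le _ (cell_lt h1 hN (hl c hc)))
    fun c hc => hT.id_le _ (cell_lt h1' hN' (hl c hc))]
  constructor
  · intro h i hi
    exact (hid ρ ρ' h1 hN h1' hN' i).1 (h i hi)
  · intro h c hc
    exact (hid ρ ρ' h1 hN h1' hN' ⟨c, hl c hc⟩).2 (h ⟨c, hl c hc⟩ hc)

theorem separator_lt {j : ℕ} (hj : j < P.k) : ∀ c ∈ P.lS j, c < P.m :=
  fun c hc => P.bag_lt j hj c (P.separator_subset j hj hc)

/-- Induction on the number of bags. If the newest bag shares column `i` with an earlier one, then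
`i` is in its separator and hence in its parent; matching gives equality with the row of the parent,
and the induction hypothesis leads from there to the earlier bag. -/
theorem Valid.row_eq (hT : Built P N tb) (hid : IdSpec N tb cols row) {x : ℕ → ℕ}
    (hv : Valid P N tb P.k x) {J : ℕ} (hJ : J ≤ P.k) (i : Fin P.m) {j j' : ℕ} (hj : j < J)
    (hj' : j' < J) (hi : (i : ℕ) ∈ P.lB j) (hi' : (i : ℕ) ∈ P.lB j') :
    row (x j) (cols i) = row (x j') (cols i) := by
  induction J generalizing j j' with
  | zero => omega
  | succ J ih =>
    have step : ∀ j', j' < J → (i : ℕ) ∈ P.lB J → (i : ℕ) ∈ P.lB j' →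
        row (x J) (cols i) = row (x j') (cols i) := by
      intro j' hj' hi hi'
      have hS := P.mem_separator J (by omega) j' hj' i hi hi'
      have hp := P.p_lt J (by omega) (by omega)
      have hm := hv J (by omega)
      have hb := mem_children hm
      have hb' := mem_children (hv (P.p J) (by omega))
      have hcode := (code_eq_iff hT hid hb.1 hb.2 hb'.1 hb'.2 (separator_lt (by omega))).1
        (mem_group.1 hm).2.2.1
      exact (hcode i hS).trans (ih (by omega) hp hj' (P.separator_parent J (by omega) i hS) hi')
    rcases Nat.lt_succ_iff_lt_or_eq.1 hj with hj | rfl <;>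
      rcases Nat.lt_succ_iff_lt_or_eq.1 hj' with hj' | rfl
    · exact ih (by omega) hj hj' hi hi'
    · exact (step j hj hi' hi).symm
    · exact step j' hj' hi hi'
    · rfl

theorem Valid.row_eq_tupleOf (hT : Built P N tb) (hid : IdSpec N tb cols row) {x : List ℕ}
    (hv : Valid P N tb P.k (x.getD · 0)) {j : ℕ} (hj : j < P.k) {i : Fin P.m}
    (hi : (i : ℕ) ∈ P.lB j) : row (x.getD j 0) (cols i) = tupleOf P cols row x (cols i) := by
  have := hv.row_eq hT hid le_rfl i hj (P.o_lt i i.2) hi (P.o_mem i i.2)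
  simpa [tupleOf] using this

/-- The tuple determines its projection to each bag, and the entry for the bag must be the first row
with that projection. So the combination can be recovered from the tuple. -/
theorem nodup_tuples (hT : Built P N tb) (hid : IdSpec N tb cols row) :
    ((combos P N tb P.k).map (tupleOf P cols row)).Nodup := by
  refine (nodup_combos P.k).map_on fun x hx y hy hxy => ?_
  obtain ⟨hx1, hx2⟩ := (mem_combos le_rfl).1 hx
  obtain ⟨hy1, hy2⟩ := (mem_combos le_rfl).1 hy
  rw [eq_pref_of_length hx1, eq_pref_of_length hy1]
  refine pref_congr fun j hj => ?_
  have hmx := mem_group.1 (hx2 j hj)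
  have hmy := mem_group.1 (hy2 j hj)
  have hcode := (code_eq_iff hT hid hmx.1 hmx.2.1 hmy.1 hmy.2.1 (P.bag_lt j hj)).2 fun i hi => by
    rw [hx2.row_eq_tupleOf hT hid hj hi, hy2.row_eq_tupleOf hT hid hj hi, hxy]
  rcases lt_trichotomy (x.getD j 0) (y.getD j 0) with h | h | h
  · exact absurd hcode (hmy.2.2.2 _ hmx.1 h)
  · exact h
  · exact absurd hcode.symm (hmx.2.2.2 _ hmy.1 h)

/-- Given a tuple whose bag projections all occur, take for each bag the first row that projects
like the tuple. Rows of child and parent then agree on the separator because both agree with the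
tuple there. -/
theorem mem_tuples (hT : Built P N tb) (hid : IdSpec N tb cols row) {t : Tuple S V} :
    t ∈ (combos P N tb P.k).map (tupleOf P cols row) ↔ ∀ j < P.k, ∃ ρ, 1 ≤ ρ ∧ ρ ≤ N ∧
      ∀ i : Fin P.m, (i : ℕ) ∈ P.lB j → row ρ (cols i) = t (cols i) := by
  classical
  rw [List.mem_map]
  constructor
  · rintro ⟨x, hx, rfl⟩ j hj
    obtain ⟨hx1, hx2⟩ := (mem_combos le_rfl).1 hx
    have hm := mem_children (hx2 j hj)
    exact ⟨x.getD j 0, hm.1, hm.2, fun i hi => hx2.row_eq_tupleOf hT hid hj hi⟩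
  · intro h
    have h' : ∀ j < P.k, ∃ ρ, (1 ≤ ρ ∧ ρ ≤ N ∧
        ∀ i : Fin P.m, (i : ℕ) ∈ P.lB j → row ρ (cols i) = t (cols i)) ∧
        ∀ ρ' < ρ, ¬ (1 ≤ ρ' ∧ ρ' ≤ N ∧
          ∀ i : Fin P.m, (i : ℕ) ∈ P.lB j → row ρ' (cols i) = t (cols i)) :=
      fun j hj => ⟨_, Nat.find_spec (h j hj), fun ρ' hρ' => Nat.find_min (h j hj) hρ'⟩
    choose! x hx hmin using h'
    have hget : ∀ i < P.k, (pref x P.k).getD i 0 = x i := fun i hi => pref_getD hi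
    have hv : Valid P N tb P.k x := by
      intro j hj
      obtain ⟨h1, h2, h3⟩ := hx j hj
      refine mem_group.2 ⟨h1, h2, ?_, ?_⟩
      · rcases Nat.eq_zero_or_pos j with rfl | h0
        · simp [P.separator_zero, codeVal]
        · have hp := P.p_lt j hj h0
          obtain ⟨g1, g2, g3⟩ := hx (P.p j) (by omega)
          refine (code_eq_iff hT hid h1 h2 g1 g2 (separator_lt hj)).2 fun i hi => ?_
          rw [h3 i (P.separator_subset j hj hi), g3 i (P.separator_parent j hj i hi)]
      · intro ρ' h1' hlt hcode
        refine hmin j hj ρ' hlt ⟨h1', by omega, fun i hi => ?_⟩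
        rw [(code_eq_iff hT hid h1' (by omega) h1 h2 (P.bag_lt j hj)).1 hcode i hi, h3 i hi]
    refine ⟨pref x P.k, (mem_combos le_rfl).2 ⟨by simp [pref], hv.congr le_rfl hget⟩, ?_⟩
    funext a
    obtain ⟨i, rfl⟩ := cols.surjective a
    have ho := P.o_lt i i.2
    simp only [tupleOf, Equiv.symm_apply_apply, hget _ ho]
    exact (hx _ ho).2.2 i (P.o_mem i i.2)

end Combos

/-! ## The layout of a decomposition -/

section Decomposition

variable {ι α N V : Type*} [Fintype ι] [DecidableEq α] {Q : JoinQuery ι α} {m : ℕ}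

open Classical in
/-- The columns whose attributes satisfy `p`. -/
noncomputable def colList (cols : Fin m ≃ Q.att) (p : α → Prop) : List ℕ :=
  (List.range m).filter fun c => ∃ h : c < m, p (cols ⟨c, h⟩)

theorem mem_colList {cols : Fin m ≃ Q.att} {p : α → Prop} {c : ℕ} :
    c ∈ colList cols p ↔ ∃ h : c < m, p (cols ⟨c, h⟩) := by
  simp only [colList, List.mem_filter, List.mem_range, decide_eq_true_eq]
  exact ⟨fun h => h.2, fun h => ⟨h.1, h⟩⟩

/-- The separator collects the columns shared with any earlier bag; the chosen order of the bags
puts them all into the parent. The bag `o c` exists since the subtree of an attribute is not empty;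
beyond `m` its value is a dummy. -/
theorem exists_layout [Finite N] (T : Decomposition Q N) (cols : Fin m ≃ Q.att) :
    ∃ (P : Layout) (e : ℕ → N), P.m = m ∧ (∀ n, ∃ j < P.k, e j = n) ∧
      ∀ j c, c ∈ P.lB j ↔ ∃ h : c < m, (cols ⟨c, h⟩ : α) ∈ T.bag (e j) := by
  obtain ⟨k, e, p, he, hp⟩ := T.exists_order
  have ho : ∀ c, ∃ j, ∀ h : c < m, j < k ∧ (cols ⟨c, h⟩ : α) ∈ T.bag (e j) := by
    intro c
    by_cases h : c < m
    · obtain ⟨n, hn⟩ := (T.connectivity (cols ⟨c, h⟩) (cols ⟨c, h⟩).2).nonempty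
      obtain ⟨j, hj, rfl⟩ := he n
      exact ⟨j, fun _ => ⟨hj, hn⟩⟩
    · exact ⟨0, fun h' => absurd h' h⟩
  choose o ho using ho
  refine ⟨{ k := k, m := m, p := p, o := o
            lB := fun j => colList cols (· ∈ T.bag (e j))
            lS := fun j => colList cols fun a => a ∈ T.bag (e j) ∧ ∃ i < j, a ∈ T.bag (e i)
            separator_zero := ?_, p_lt := fun j hj h0 => (hp j hj h0).1
            separator_subset := ?_, bag_lt := ?_, separator_parent := ?_, mem_separator := ?_
            o_lt := fun c hc => (ho c hc).1, o_mem := fun c hc => mem_colList.2 ⟨hc, (ho c hc).2⟩ },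
    e, rfl, he, fun j c => mem_colList⟩
  · refine List.eq_nil_iff_forall_not_mem.2 fun c hc => ?_
    obtain ⟨_, _, i, hi, -⟩ := mem_colList.1 hc
    omega
  · intro j _ c hc
    obtain ⟨h, h1, -⟩ := mem_colList.1 hc
    exact mem_colList.2 ⟨h, h1⟩
  · intro j _ c hc
    exact (mem_colList.1 hc).1
  · intro j hj c hc
    obtain ⟨h, h1, i, hi, h2⟩ := mem_colList.1 hc
    exact mem_colList.2 ⟨h, (hp j hj (by omega)).2 i hi _ h1 h2⟩
  · intro j hj i hi c hc hci
    obtain ⟨h, h1⟩ := mem_colList.1 hc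
    obtain ⟨_, h2⟩ := mem_colList.1 hci
    exact mem_colList.2 ⟨h, h1, i, hi, h2⟩

variable {T : Decomposition Q N} {D : Q.Database V} {K : Finset (Tuple Q.att V)}

/-- Each schema is covered by a bag, on which the given tuple agrees with a row of `K` and therefore
with a result tuple. So its restriction to the schema belongs to the relation. -/
theorem ResultPreserving.mem_result_iff (hK : ResultPreserving T D K) {t : Tuple Q.att V} :
    t ∈ Q.result D ↔ ∀ n, ∃ u ∈ K, Tuple.restrict (T.bag_subset n) u =
      Tuple.restrict (T.bag_subset n) t := by
  constructor
  · intro ht n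
    have : Tuple.restrict (T.bag_subset n) t ∈ proj (T.bag_subset n) (Q.result D) := ⟨t, ht, rfl⟩
    rw [← hK n] at this
    exact this
  · intro h i
    obtain ⟨n, hn⟩ := T.coverage i
    obtain ⟨u, hu, hut⟩ := h n
    have : Tuple.restrict (T.bag_subset n) u ∈ proj (T.bag_subset n) (Q.result D) :=
      hK n ▸ ⟨u, hu, rfl⟩
    obtain ⟨t', ht', e⟩ := this
    have hrestr : Tuple.restrict (Q.schema_subset_att i) t =
        Tuple.restrict (Q.schema_subset_att i) t' := by
      funext a
      exact (congrFun (e.trans hut) ⟨a, hn a.2⟩).symm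
    rw [hrestr]
    exact ht' i

/-- The rows of `K` are result tuples, and a result tuple is determined by its restrictions to the
schemas, which cover all attributes. -/
theorem ResultPreserving.card_le (hK : ResultPreserving T D K) :
    K.card ≤ Q.dbSize D ^ Fintype.card ι := by
  classical
  have hsub : ∀ t ∈ K, t ∈ Q.result D := fun t ht => hK.mem_result_iff.2 fun n => ⟨t, ht, rfl⟩
  calc K.card ≤ (Fintype.piFinset D).card := by
        refine Finset.card_le_card_of_injOn
          (fun t i => Tuple.restrict (Q.schema_subset_att i) t) (fun t ht => ?_) ?_
        · exact Fintype.mem_piFinset.2 (hsub t ht)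
        · intro t _ t' _ h
          funext a
          obtain ⟨i, -, hi⟩ := Finset.mem_biUnion.1 a.2
          exact congrFun (congrFun h i) ⟨a, hi⟩
    _ = ∏ i, (D i).card := Fintype.card_piFinset D
    _ ≤ ∏ _i : ι, Q.dbSize D := Finset.prod_le_prod' fun i _ =>
        Finset.single_le_sum (f := fun i => (D i).card) (fun _ _ => Nat.zero_le _)
          (Finset.mem_univ i)
    _ = Q.dbSize D ^ Fintype.card ι := by simp

end Decomposition

/-! ## Bounds -/

section Bounds

variable (P : Layout)

theorem exists_buildAllTime_le (j : ℕ) : ∃ b, ∀ N, P.buildAllTime N j ≤ b * (N + 1) := by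
  induction j with
  | zero => exact ⟨0, fun N => by simp [Layout.buildAllTime]⟩
  | succ j ih =>
    obtain ⟨b, hb⟩ := ih
    refine ⟨b + (10 * ((P.lB j).length + (P.lS j).length) + 28), fun N => ?_⟩
    have := hb N
    rw [Layout.buildAllTime]
    generalize 10 * ((P.lB j).length + (P.lS j).length) = q
    nlinarith [Nat.zero_le (N * q)]

theorem exists_preTime_le : ∃ a, ∀ N L, P.preTime N L ≤ a * (N * (L + 1) + 1) := by
  obtain ⟨b, hb⟩ := exists_buildAllTime_le P P.k
  refine ⟨60 * P.m + b + P.descendAllTime P.k + 20, fun N L => ?_⟩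
  have h := hb N
  have h1 : N ≤ N * (L + 1) := Nat.le_mul_of_pos_right _ (Nat.succ_pos L)
  have h2 : b * (N + 1) ≤ b * (N * (L + 1) + 1) := Nat.mul_le_mul_left _ (by omega)
  have h3 : N * P.m ≤ P.m * (N * (L + 1)) := by
    rw [mul_comm N P.m]
    exact Nat.mul_le_mul_left _ h1
  have h4 : N * P.m * (20 * L + 20) = 20 * (P.m * (N * (L + 1))) := by ring
  have h5 : (N * P.m - 1) * 20 ≤ N * P.m * 20 := Nat.mul_le_mul_right _ (Nat.sub_le _ _)
  rw [Layout.preTime, h4]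
  simp only [max_eq_left (Nat.zero_le _)]
  nlinarith [Nat.zero_le (P.descendAllTime P.k * (N * (L + 1)))]

theorem le_two_add_pow (N a : ℕ) : a ≤ (N + 2) ^ a :=
  (Nat.lt_two_pow_self).le.trans (Nat.pow_le_pow_left (by omega) a)

/-- Tree nodes, row numbers and codes are all polynomial in `N`, with exponents that depend only on
the layout. -/
theorem exists_room : ∃ c, ∀ N, ∃ X, Room P N X ∧ (X + 1) * P.C ≤ (N + 2) ^ c := by
  set L := ∑ j ∈ Finset.range P.k, ((P.lB j).length + (P.lS j).length) with hL
  have hlen : ∀ j < P.k, (P.lB j).length + (P.lS j).length ≤ L := fun j hj =>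
    Finset.single_le_sum (f := fun j => (P.lB j).length + (P.lS j).length)
      (fun _ _ => Nat.zero_le _) (Finset.mem_range.2 hj)
  refine ⟨(P.m + 1) * L + P.m + 5 + P.C, fun N =>
    ⟨(N * P.m + 1) ^ L + 2 * (N * P.m) + N + 1, ⟨by omega, by omega, ?_, ?_⟩, ?_⟩⟩
  · intro j hj
    have := Nat.pow_le_pow_right (show 0 < N * P.m + 1 by omega)
      (show (P.lB j).length ≤ L by have := hlen j hj; omega)
    omega
  · intro j hj
    have := Nat.pow_le_pow_right (show 0 < N * P.m + 1 by omega)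
      (show (P.lS j).length ≤ L by have := hlen j hj; omega)
    omega
  · have hM : N * P.m + 1 ≤ (N + 2) ^ (P.m + 1) := by
      have h := (Nat.lt_two_pow_self (n := P.m)).trans_le
        (Nat.pow_le_pow_left (by omega : 2 ≤ N + 2) P.m)
      rw [pow_succ]
      nlinarith
    have h2 : 2 ≤ N + 2 := by omega
    set b := N + 2 with hb
    -- With this exponent the sum in question is at most `8 * b ^ a`. The factor 8 is absorbed by `b
    -- ^ 3` and the stride `P.C` by `b ^ P.C`.
    set a := (P.m + 1) * L + P.m + 2 with ha
    have e1 : (N * P.m + 1) ^ L ≤ b ^ a := by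
      calc (N * P.m + 1) ^ L ≤ (b ^ (P.m + 1)) ^ L := Nat.pow_le_pow_left hM L
        _ = b ^ ((P.m + 1) * L) := (pow_mul _ _ _).symm
        _ ≤ b ^ a := Nat.pow_le_pow_right (by omega) (by omega)
    have e2 : N * P.m + 1 ≤ b ^ a := hM.trans (Nat.pow_le_pow_right (by omega) (by
      have := Nat.zero_le ((P.m + 1) * L)
      omega))
    have e3 : b ≤ b ^ a := Nat.le_self_pow (by omega) b
    have e4 : 8 ≤ b ^ 3 := by
      calc 8 = 2 ^ 3 := by norm_num
        _ ≤ b ^ 3 := Nat.pow_le_pow_left h2 3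
    calc ((N * P.m + 1) ^ L + 2 * (N * P.m) + N + 1 + 1) * P.C
        ≤ (b ^ a * b ^ 3) * b ^ P.C := by
          refine Nat.mul_le_mul ?_ (le_two_add_pow N P.C)
          calc (N * P.m + 1) ^ L + 2 * (N * P.m) + N + 1 + 1 ≤ b ^ a * 8 := by omega
            _ ≤ b ^ a * b ^ 3 := Nat.mul_le_mul_left _ e4
      _ = b ^ ((P.m + 1) * L + P.m + 5 + P.C) := by
          rw [← pow_add, ← pow_add]

theorem exists_preTime_le_log (n : ℕ) : ∃ a, ∀ N d, N ≤ d ^ n → ∃ L,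
    2 * (N * P.m) ≤ 2 ^ (L + 1) ∧ P.preTime N L ≤ a * (N * Nat.log 2 d + 1) := by
  obtain ⟨a, ha⟩ := exists_preTime_le P
  -- The depth comes from `P.m ≤ 2 ^ P.m` and `d ≤ 2 ^ (log d + 1)`. For `l = log d ≥ 1` the depth
  -- plus one is at most `(P.m + 2 * n + 3) * l`.
  refine ⟨a * (P.m + 2 * n + 3), fun N d hN => ⟨P.m + n * (Nat.log 2 d + 1), ?_, ?_⟩⟩
  · have h1 : d ^ n ≤ 2 ^ (n * (Nat.log 2 d + 1)) := by
      rw [mul_comm, pow_mul]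
      exact Nat.pow_le_pow_left (Nat.lt_pow_succ_log_self (by norm_num) d).le n
    have h2 : N * P.m ≤ 2 ^ (n * (Nat.log 2 d + 1)) * 2 ^ P.m :=
      Nat.mul_le_mul (hN.trans h1) Nat.lt_two_pow_self.le
    rw [pow_succ, pow_add]
    nlinarith
  · refine (ha _ _).trans ?_
    rw [mul_assoc]
    refine Nat.mul_le_mul_left _ ?_
    -- If the logarithm vanishes, then `d ≤ 1` and so `N ≤ 1`: the constant term pays for the whole
    -- computation.
    rcases Nat.eq_zero_or_pos (Nat.log 2 d) with h | h
    · have hd : d ≤ 1 := by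
        rcases (Nat.log_eq_zero_iff.1 h) with h | h <;> omega
      have hN1 : N ≤ 1 := hN.trans ((Nat.pow_le_pow_left hd n).trans (one_pow n).le)
      rw [h]
      nlinarith
    · generalize Nat.log 2 d = l at h ⊢
      have : P.m + n * (l + 1) + 1 ≤ (P.m + 2 * n + 3) * l := by nlinarith
      nlinarith [Nat.mul_le_mul_left N this]

end Bounds

/-! ## The input -/

section Input

variable {V α : Type*} {S : Finset α} {m : ℕ} {cols : Fin m ≃ S} {rows : List (Tuple S V)}

theorem input_cell {r : ℕ} (hr : r < rows.length) (i : Fin m) :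
    (inputState cols rows).dat (.mem (r * m + i)) = some (rows[r] (cols i)) := by
  have h1 : (r * m + i) % m = i := by rw [Nat.mul_add_mod', Nat.mod_eq_of_lt i.2]
  have h2 : (r * m + i) / m = r := by
    rw [mul_comm, Nat.mul_add_div (by have := i.2; omega), Nat.div_eq_of_lt i.2, add_zero]
  simp [inputState, h1, h2, hr]

theorem input_end : (inputState cols rows).dat (.mem (rows.length * m)) = none := by
  rcases Nat.eq_zero_or_pos m with rfl | h
  · simp [inputState]
  · simp [inputState, Nat.mul_div_cancel _ h]

theorem input_ne_none {a : ℕ} (h : a < rows.length * m) :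
    (inputState cols rows).dat (.mem a) ≠ none := by
  have hm : 0 < m := Nat.pos_of_ne_zero (by rintro rfl; simp at h)
  have := input_cell (cols := cols) (r := a / m) (rows := rows)
    (Nat.div_lt_of_lt_mul (by rwa [mul_comm])) ⟨a % m, Nat.mod_lt _ hm⟩
  rw [Nat.div_add_mod'] at this
  simp [this]

theorem input_wordBound {B : ℕ} (h : rows.length ≤ B) : (inputState cols rows).WordBound B := by
  intro l
  rcases l with (_ | k) | a <;> simp [inputState, h]

end Input

end CoverEnum

/-! ### Assembly of the two programs and their bounds -/

theorem mainTheorem5 {ι α N : Type*} [Fintype ι] [DecidableEq α] [Finite N]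
    (Q : CoverEnum.JoinQuery ι α) (T : CoverEnum.Decomposition Q N)
    {m : ℕ} (cols : Fin m ≃ Q.att) :
    ∃ (pre next : CoverEnum.Prog) (c : ℕ),
      ∀ (V : Type*) [LinearOrder V] (D : Q.Database V) (K : Finset (CoverEnum.Tuple Q.att V)),
        CoverEnum.IsCover T D K →
        ∀ rows : List (CoverEnum.Tuple Q.att V), rows.Nodup → (∀ t, t ∈ rows ↔ t ∈ K) →
          ∃ (tr : List (CoverEnum.State V)) (s : CoverEnum.State V)
            (W : Finset CoverEnum.Loc) (ts : List (CoverEnum.Tuple Q.att V)),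
            CoverEnum.Exec pre (CoverEnum.inputState cols rows) tr s ∧
            tr.length ≤ c * (K.card * Nat.log 2 (Q.dbSize D) + 1) ∧
            (∀ st ∈ tr, st.WordBound ((K.card + 2) ^ c)) ∧
            ts.Nodup ∧ (∀ t, t ∈ ts ↔ t ∈ Q.result D) ∧
            W.card ≤ c ∧
            CoverEnum.Enumerates next cols c
              (fun st => st.WordBound ((K.card + 2) ^ c) ∧
                CoverEnum.State.AgreeOutside W st s) s ts := by
  open CoverEnum in
  classical
  obtain ⟨P, e, rfl, he, hlB⟩ := exists_layout T cols
  obtain ⟨c₁, hc₁⟩ := exists_room P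
  obtain ⟨c₂, hc₂⟩ := exists_preTime_le_log P (Fintype.card ι)
  -- The constant is a sum so as to dominate each requirement: the exponent of the word bound, both
  -- time bounds and the number of registers in use.
  refine ⟨P.pre, P.next, c₁ + c₂ + P.m + P.nextTime + (20 + P.k + P.m) + 1, ?_⟩
  set c := c₁ + c₂ + P.m + P.nextTime + (20 + P.k + P.m) + 1 with hc
  intro V _ D K hK rows hnd hrows
  have hlen : rows.length = K.card := by
    rw [← List.toFinset_card_of_nodup hnd]
    congr 1
    ext t
    rw [List.mem_toFinset, hrows]
  obtain ⟨X, hR, hX⟩ := hc₁ K.card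
  obtain ⟨L, hL, htime⟩ := hc₂ K.card (Q.dbSize D) hK.1.card_le
  have hpow : ∀ a ≤ c, (K.card + 2) ^ a ≤ (K.card + 2) ^ c := fun a ha =>
    Nat.pow_le_pow_right (by omega) ha
  have hk : 0 < P.k := by
    obtain ⟨n⟩ := T.isTree.connected.nonempty
    obtain ⟨j, hj, -⟩ := he n
    omega
  have hCC : 2 ≤ P.C := by rw [Layout.C]; omega
  have hB : Cap ((K.card + 2) ^ c) P.C X := ⟨hCC, hX.trans (hpow _ (by omega))⟩
  have hwb : (inputState cols rows).WordBound ((K.card + 2) ^ c) :=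
    input_wordBound (by rw [hlen]; exact hB.idx hR.rows)
  obtain ⟨tr, s, h1, h2, h3, h4, tb, hT, hid, hinv⟩ := runs_pre (P := P) (N := K.card) (L := L)
    (s := inputState cols rows) (inp := fun a => (inputState cols rows).dat (.mem a)) hB hR
    ((le_two_add_pow _ _).trans (hpow P.m (by omega))) hlen
    (by rintro (_ | i) h
        · exact absurd rfl h
        · rfl)
    (fun _ => rfl) (fun _ => rfl) (fun _ => rfl) (by rw [← hlen]; exact input_end)
    (fun r hr => input_ne_none (by rw [hlen]; exact hr)) hL hwb
  have hresult : ∀ t, t ∈ Q.result D ↔ ∀ j < P.k, ∃ u ∈ K,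
      ∀ i : Fin P.m, (i : ℕ) ∈ P.lB j → u (cols i) = t (cols i) := by
    intro t
    rw [hK.1.mem_result_iff]
    constructor
    · intro h j hj
      obtain ⟨u, hu, hut⟩ := h (e j)
      refine ⟨u, hu, fun i hi => ?_⟩
      obtain ⟨_, hb⟩ := (hlB j i).1 hi
      exact congrFun hut ⟨cols i, hb⟩
    · intro h n
      obtain ⟨j, hj, rfl⟩ := he n
      obtain ⟨u, hu, hut⟩ := h j hj
      refine ⟨u, hu, ?_⟩
      funext a
      have := hut (cols.symm ⟨a, T.bag_subset _ a.2⟩) ((hlB j _).2 ⟨Fin.is_lt _, by simp⟩)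
      simpa [Tuple.restrict] using this
  have hWcard : (lowRegs (20 + P.k + P.m)).card ≤ c := by
    refine Finset.card_image_le.trans ?_
    rw [Finset.card_range]
    omega
  suffices H : ∃ ts : List (Tuple Q.att V), ts.Nodup ∧ (∀ t, t ∈ ts ↔ t ∈ Q.result D) ∧
      Enumerates P.next cols P.nextTime (fun st => st.WordBound ((K.card + 2) ^ c) ∧
        State.AgreeOutside (lowRegs (20 + P.k + P.m)) st s) s ts by
    obtain ⟨ts, ht1, ht2, ht3⟩ := H
    refine ⟨tr, s, lowRegs (20 + P.k + P.m), ts, h1, h2.trans (htime.trans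
      (Nat.mul_le_mul_right _ (by omega))), h3, ht1, ht2, hWcard, ht3.mono (by omega)⟩
  -- If `K` is empty, so is the result: there is at least one bag, and its projection has no tuples.
  rcases Nat.eq_zero_or_pos K.card with h0 | h0
  · rw [if_pos h0] at hinv
    refine ⟨[], List.nodup_nil, fun t => ?_, ?_⟩
    · rw [hresult]
      refine iff_of_false (by simp) fun h => ?_
      obtain ⟨u, hu, -⟩ := h 0 hk
      exact Finset.card_ne_zero_of_mem hu h0
    · obtain ⟨tr', s', g1, g2, g3, -, g5⟩ := runs_next_nil hinv h4
      exact .done g1 g2 (fun st hst => ⟨g3 st hst, (g1.agreeOutside (within_next P)).1 st hst⟩) g5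
  · rw [if_neg (by omega)] at hinv
    -- Rows are numbered from 1; the default value is not reached for `1 ≤ ρ ≤ K.card`.
    let row : ℕ → Tuple Q.att V := fun ρ => rows.getD (ρ - 1) (rows[0]'(by omega))
    have hrow : ∀ ρ, 1 ≤ ρ → ρ ≤ K.card → ∀ i : Fin P.m,
        (inputState cols rows).dat (.mem ((ρ - 1) * P.m + i)) = some (row ρ (cols i)) := by
      intro ρ g1 g2 i
      rw [input_cell (show ρ - 1 < rows.length by omega)]
      simp only [row]
      rw [List.getD_eq_getElem _ _ (by omega)]
    have hspec : IdSpec K.card tb cols row := by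
      intro ρ ρ' g1 g2 g1' g2' i
      rw [hid _ (cell_lt g1 g2 i.2) _ (cell_lt g1' g2' i.2), hrow ρ g1 g2, hrow ρ' g1' g2',
        Option.some.injEq]
    refine ⟨_, nodup_tuples hT hspec, fun t => ?_, enumerates_next hB hR hT hrow h4
      (State.AgreeOutside.refl _ s) hinv⟩
    rw [mem_tuples hT hspec, hresult]
    refine forall₂_congr fun j hj => ⟨?_, ?_⟩
    · rintro ⟨ρ, g1, g2, h⟩
      refine ⟨row ρ, (hrows _).1 ?_, h⟩
      simp only [row]
      rw [List.getD_eq_getElem _ _ (by omega)]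
      exact List.getElem_mem _
    · rintro ⟨u, hu, h⟩
      obtain ⟨r, hr, rfl⟩ := List.getElem_of_mem ((hrows u).2 hu)
      refine ⟨r + 1, by omega, by omega, ?_⟩
      simp only [row, Nat.add_sub_cancel]
      rwa [List.getD_eq_getElem _ _ hr]
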